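/- **Setting.** Let $k:\mathbb R\to(0,\infty)$ be an even function with $\int_{\mathbb R} k=1$, and let $\mathcal H$ be the reproducing kernel Hilbert space of functions $f:\mathbb R\to\mathbb C$, $f(x)=\int\hat f(\omega)e^{2\pi i x\omega}d\omega$, with $\|f\|_{\mathcal H}^2=\int |\hat f(\omega)|^2/k(\omega)\,d\omega<\infty$. Fix $\lambda>0$. For random variables $X\in\mathbb R$ and $Y\in\mathbb C$ with $\mathbb E|Y|^2<\infty$, and for $\Sigma=U^2\ge 0$, put $$\mathcal J(\Sigma)=\inf_{f\in\mathcal H}\Big(\tfrac12\mathbb E|Y-f(UX)|^2+\tfrac{\lambda}{2}\|f\|_{\mathcal H}^2\Big),$$ which depends only on $\Sigma$. For $\epsilon>0$ and $\Lambda>1$, a number $\Sigma>0$ is an $(\epsilon,\Lambda)$-*scale detector* if it is a local minimizer of $\mathcal J$ on $[0,\infty)$, $\mathcal J(\Sigma')\ge\mathcal J(\Sigma)$ whenever $\Lambda^{-1}\Sigma\le\Sigma'\le\Lambda\Sigma$, and $\mathcal J(\Sigma')\ge\mathcal J(\Sigma)+\epsilon\,\mathbb E|Y|^2$ for the two endpoints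 $\Sigma'=\Lambda^{\pm1}\Sigma$. Let $m\ge1$. Let $X_0$ be a random variable with values in $\{1,\dots,m\}$, $\mathbb P(X_0=i)>0$ for every $i$, and $\chi_i=\mathbf 1_{X_0=i}$. Let $Z_1,\dots,Z_m$ be real random variables with atomless laws, $\mathbb E|Z_i|^2<\infty$ and $\mathbb E Z_i=0$, such that $X_0,Z_1,\dots,Z_m$ are independent. Let $g_i:\mathbb R\to\mathbb C$ be measurable with $0<\mathbb E|g_i(Z_i)|^2<\infty$ and $\mathbb E\,g_i(Z_i)=0$. These data are fixed. For $\sigma_i>0$ and $a_i\in\mathbb R$ put $$X=\sum_{i=1}^m\chi_i(a_i+\sigma_iZ_i).$$ **Theorem.** There are $\epsilon>0$ and $\Lambda>1$, depending only on the fixed data, such that for every $C>0$ there is $\delta>0$ with the following property. Let $\sigma_i>0$ and $a_i\in\mathbb R$ satisfy $\sigma_i/\sigma_{i+1}\le\delta$ for $1\le i<m$ and $|a_i-a_j|\ge C^{-1}\sigma_m$ for $i\ne j$. Let $Y$ be a complex random variable with $\mathbb E|Y|^2<\infty$ that is given by $g_i$ on the $i$-th cluster up to a small error: $$\mathbb E\Big[\chi_i\,\Big|Y-g_i\Big(\frac{X-a_i}{\sigma_i}\Big)\Big|^2\Big]\le\delta,\qquad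 i=1,\dots,m.$$ (For instance $Y=\sum_i\chi_i\,g_i\big(\frac{X-a_i}{\sigma_i}\big)$, or $Y=\sum_i g_i\big(\frac{X-a_i}{\sigma_i}\big)$ if $\mathbb E\big[\chi_i\big|\sum_{j\ne i}g_j\big(\frac{X-a_j}{\sigma_j}\big)\big|^2\big]\le\delta$ for every $i$.) Then: 1. every $(\epsilon,\Lambda)$-scale detector $\Sigma$ satisfies $\Lambda^{-1}\sigma_i^{-2}<\Sigma<\Lambda\sigma_i^{-2}$ for some $i\in\{1,\dots,m\}$; 2. for each $i=1,\dots,m$ there is an $(\epsilon,\Lambda^2)$-scale detector $\Sigma$ with $\Lambda^{-1}\sigma_i^{-2}<\Sigma<\Lambda\sigma_i^{-2}$. -/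

import Mathlib

open MeasureTheory ProbabilityTheory

noncomputable section

namespace KernelLearning

/-- The Fourier weight `k_V` of a translation invariant reproducing kernel Hilbert space on `ℝ`:
strictly positive, of total integral one (in particular integrable), and rotationally invariant,
which on the line means even. -/
structure IsFourierWeight (k : ℝ → ℝ) : Prop where
  pos : ∀ w, 0 < k w
  even : ∀ w, k (-w) = k w
  integral_eq_one : ∫ w, k w = 1

/-- The Hilbert space `𝓗 = {f : ∫ |f̂|² / k < ∞}` of complex valued functions on `ℝ`.
An element is a function together with its Fourier transform `ft`, in the convention
`f x = ∫ f̂ w e^{2 π i x w} dw`.  As `k` has integral one, finiteness of `∫ |f̂|² / k` forces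
`f̂` to be integrable (Cauchy-Schwarz), so the inversion formula makes sense pointwise and picks
the continuous representative of `f`; `ft` is determined by `f` up to null sets. -/
structure RKHS (k : ℝ → ℝ) where
  toFun : ℝ → ℂ
  ft : ℝ → ℂ
  integrable_ft : Integrable ft
  integrable_sq : Integrable (fun w => ‖ft w‖ ^ 2 / k w)
  inversion : ∀ x, toFun x = ∫ w, ft w * Complex.exp (2 * Real.pi * Complex.I * x * w)

/-- The squared norm `‖f‖²_𝓗 = ∫ |f̂|² / k`. -/
def RKHS.normSq {k : ℝ → ℝ} (f : RKHS k) : ℝ := ∫ w, ‖f.ft w‖ ^ 2 / k w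

/-- The zero function. -/
instance (k : ℝ → ℝ) : Inhabited (RKHS k) :=
  ⟨{ toFun := fun _ => 0
     ft := fun _ => 0
     integrable_ft := integrable_zero _ _ _
     integrable_sq := by simp
     inversion := by simp }⟩

variable {Ω : Type*} [MeasurableSpace Ω]

/-- The loss `I(f, U, lam) = ½ E|Y - f(U X)|² + (lam/2) ‖f‖²_𝓗`. -/
def loss (P : Measure Ω) (k : ℝ → ℝ) (lam : ℝ) (X : Ω → ℝ) (Y : Ω → ℂ) (f : RKHS k) (U : ℝ) : ℝ :=
  1 / 2 * ∫ ω, ‖Y ω - f.toFun (U * X ω)‖ ^ 2 ∂P + lam / 2 * f.normSq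

/-- `J(U, lam) = inf_f I(f, U, lam)`. -/
def minLoss (P : Measure Ω) (k : ℝ → ℝ) (lam : ℝ) (X : Ω → ℝ) (Y : Ω → ℂ) (U : ℝ) : ℝ :=
  ⨅ f : RKHS k, loss P k lam X Y f U

/-- The functional `𝓙(S; lam)` of the (semi-definite) inner product `S ≥ 0` on `ℝ`: it is
`J(U, lam)` for `S = U²`. -/
def calJ (P : Measure Ω) (k : ℝ → ℝ) (lam : ℝ) (X : Ω → ℝ) (Y : Ω → ℂ) (S : ℝ) : ℝ :=
  minLoss P k lam X Y (Real.sqrt S)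

/-- The `L`-neighbourhood of the inner product `S` among the inner products on `ℝ`. -/
def scaleNhd (S L : ℝ) : Set ℝ := {S' | 0 < S' ∧ L⁻¹ * S ≤ S' ∧ S' ≤ L * S}

/-- A vacuum: a local minimizer of `𝓙` among the semi-definite inner products `[0, ∞)`. -/
def IsVacuum (P : Measure Ω) (k : ℝ → ℝ) (lam : ℝ) (X : Ω → ℝ) (Y : Ω → ℂ) (S : ℝ) : Prop :=
  0 ≤ S ∧ IsLocalMinOn (calJ P k lam X Y) (Set.Ici 0) S

/-- An `(e, L)`-scale detector: a vacuum among the positive definite inner products which minimizes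
`𝓙` on its `L`-neighbourhood, with a gap of `e E|Y|²` on the boundary of that neighbourhood. -/
structure IsScaleDetector (P : Measure Ω) (k : ℝ → ℝ) (lam : ℝ) (X : Ω → ℝ) (Y : Ω → ℂ)
    (e L S : ℝ) : Prop where
  pos : 0 < S
  isVacuum : IsVacuum P k lam X Y S
  minimizing : ∀ S' ∈ scaleNhd S L, calJ P k lam X Y S ≤ calJ P k lam X Y S'
  gap : ∀ S' ∈ frontier (scaleNhd S L),
    calJ P k lam X Y S + e * ∫ ω, ‖Y ω‖ ^ 2 ∂P ≤ calJ P k lam X Y S'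

/-- The clustered variable `X = ∑ χ_i (a_i + σ_i Z_i)` with `χ_i` the indicator of `X₀ = i`. -/
def clusterX {m : ℕ} (X₀ : Ω → Fin m) (Z : Fin m → Ω → ℝ) (a σ : Fin m → ℝ) (ω : Ω) : ℝ :=
  ∑ i, (X₀ ⁻¹' {i}).indicator (fun ω => a i + σ i * Z i ω) ω

end KernelLearning

end

/-!
For a target `Y` over `X` let `Φ t = E[Y e^{-2πitX}]` be the `twistedMean`, and let
`Q U = ∫ k w ‖Φ (U w)‖² dw` be the `kernelEnergy`. By Fubini the correlation of `Y` with `f(UX)` is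
the pairing of `f̂` with `Φ (U ·)` (`integral_conj_mul_comp`). Dropping `E|f(UX)|²` from the loss
(`le_minLoss`), or bounding it by `‖f‖²` for `f̂` a multiple of `k Φ (U ·)` (`minLoss_le`), gives

  `½ E|Y|² - Q U / (2 lam) ≤ J(U) ≤ ½ E|Y|² - Q U / (2 (1 + lam))`.

So, up to constants, the depth of `𝓙(U²)` below its upper bound `½ E|Y|²` is the energy `Q U`, and
scale detectors can only sit where `Q` is not small.

By independence, `Φ` is up to the error of the target a sum over the clusters of phases times the
transforms of `g_i(Z_i)` over `Z_i`, dilated by `σ_i` (`twistedMean_clusterTarget`). The phases,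
that is the centers `a_i`, do not affect the norms, so `Q U` is compared with the energies
`q_i (U σ_i)` of the single clusters by the triangle inequality in both directions
(`kernelEnergy_le_sum_clusterEnergy`, `clusterEnergy_le`). Each `q_i` tends to `0` at `0` because
`g_i(Z_i)` is centered, tends to `0` at infinity because `Z_i` has no atoms
(`tendsto_kernelEnergy_atTop`, by Riemann-Lebesgue), and is positive at `1` because a finite
complex measure is determined by its Fourier transform (`kernelEnergy_pos`). Hence outside a fixed
window around the scale `σ_i⁻²` the `i`-th cluster is invisible, and separated scales do not
interact: `𝓙` is within a small distance of `½ E|Y|²` away from all the `σ_i⁻²` and has a dip of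
fixed depth at each of them. Since `𝓙` is lower semicontinuous (`lowerSemicontinuous_calJ`), it
attains a minimum on the window around `σ_i⁻²`, and this minimizer is a detector
(`exists_isScaleDetector`).
-/

open Filter Topology ComplexConjugate

namespace KernelLearning

/-! ### Characters and twisted means -/

/-- The Fourier transform `t ↦ E[Y e^{-2πitX}]` of the complex measure obtained by pushing `Y P`
forward along `X`. -/
noncomputable def twistedMean {Ω : Type*} [MeasurableSpace Ω] (P : Measure Ω) (X : Ω → ℝ)
    (Y : Ω → ℂ) (t : ℝ) : ℂ :=
  ∫ ω, Y ω * (Real.fourierChar (-(t * X ω)) : ℂ) ∂P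

/-- The square of the norm of `E[Y K(·, sX)]` in the Hilbert space with reproducing kernel
`K(x, y) = ∫ k w e^{2πi(x - y)w} dw`, written as an integral over frequencies. -/
noncomputable def kernelEnergy {Ω : Type*} [MeasurableSpace Ω] (P : Measure Ω) (k : ℝ → ℝ)
    (X : Ω → ℝ) (Y : Ω → ℂ) (s : ℝ) : ℝ :=
  ∫ w, k w * ‖twistedMean P X Y (s * w)‖ ^ 2

theorem exp_eq_fourierChar (x w : ℝ) :
    Complex.exp (2 * Real.pi * Complex.I * x * w) = (Real.fourierChar (x * w) : ℂ) := by
  rw [Real.fourierChar_apply]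
  congr 1
  push_cast
  ring

theorem fourierChar_add (x y : ℝ) :
    (Real.fourierChar (x + y) : ℂ) = (Real.fourierChar x : ℂ) * (Real.fourierChar y : ℂ) := by
  rw [AddChar.map_add_eq_mul, Circle.coe_mul]

theorem conj_fourierChar (x : ℝ) :
    conj (Real.fourierChar x : ℂ) = (Real.fourierChar (-x) : ℂ) := by
  rw [AddChar.map_neg_eq_inv, Circle.coe_inv_eq_conj]

theorem continuous_coe_fourierChar : Continuous fun x : ℝ => (Real.fourierChar x : ℂ) :=
  continuous_induced_dom.comp Real.continuous_fourierChar

theorem norm_fourierChar_sub (x y : ℝ) :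
    ‖(Real.fourierChar x : ℂ) - (Real.fourierChar y : ℂ)‖
      = ‖(Real.fourierChar (x - y) : ℂ) - 1‖ := by
  have h : (Real.fourierChar x : ℂ) - (Real.fourierChar y : ℂ)
      = (Real.fourierChar y : ℂ) * ((Real.fourierChar (x - y) : ℂ) - 1) := by
    rw [mul_sub, ← fourierChar_add, mul_one]
    congr 3
    ring
  rw [h, norm_mul, Circle.norm_coe, one_mul]

theorem norm_fourierChar_sub_one_le (x : ℝ) : ‖(Real.fourierChar x : ℂ) - 1‖ ≤ 2 := by
  refine (norm_sub_le _ _).trans ?_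
  rw [Circle.norm_coe, norm_one]
  norm_num

theorem IsFourierWeight.integrable {k : ℝ → ℝ} (hk : IsFourierWeight k) : Integrable k := by
  by_contra h
  have := hk.integral_eq_one
  rw [integral_undef h] at this
  exact zero_ne_one this

section TwistedMean

variable {Ω : Type*} [MeasurableSpace Ω] {P : Measure Ω} {X : Ω → ℝ} {Y : Ω → ℂ} {k : ℝ → ℝ}

theorem integrable_mul_fourierChar {u : Ω → ℝ} (hY : Integrable Y P) (hu : Measurable u) :
    Integrable (fun ω => Y ω * (Real.fourierChar (u ω) : ℂ)) P := by
  refine hY.mul_bdd (c := 1)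
    (continuous_coe_fourierChar.measurable.comp hu).aestronglyMeasurable ?_
  exact Eventually.of_forall fun ω => (Circle.norm_coe _).le

theorem norm_twistedMean_le (t : ℝ) : ‖twistedMean P X Y t‖ ≤ ∫ ω, ‖Y ω‖ ∂P := by
  refine (norm_integral_le_integral_norm _).trans (le_of_eq ?_)
  simp [Circle.norm_coe]

theorem continuous_twistedMean (hX : Measurable X) (hY : Integrable Y P) :
    Continuous (twistedMean P X Y) := by
  refine continuous_of_dominated (bound := fun ω => ‖Y ω‖) (fun t => ?_) (fun t => ?_) hY.norm ?_
  · exact (integrable_mul_fourierChar hY (by fun_prop)).aestronglyMeasurable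
  · exact Eventually.of_forall fun ω => by simp [Circle.norm_coe]
  · refine Eventually.of_forall fun ω => continuous_const.mul ?_
    exact continuous_coe_fourierChar.comp (by fun_prop)

theorem twistedMean_sum {ι : Type*} [Fintype ι] {G : ι → Ω → ℂ} (hX : Measurable X)
    (hG : ∀ i, Integrable (G i) P) (t : ℝ) :
    twistedMean P X (fun ω => ∑ i, G i ω) t = ∑ i, twistedMean P X (G i) t := by
  unfold twistedMean
  rw [← integral_finsetSum _ fun i _ => integrable_mul_fourierChar (hG i) (by fun_prop)]
  simp only [Finset.sum_mul]

theorem integrable_kernelEnergy (hk : IsFourierWeight k) (hX : Measurable X)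
    (hY : Integrable Y P) (s : ℝ) :
    Integrable fun w => k w * ‖twistedMean P X Y (s * w)‖ ^ 2 := by
  refine hk.integrable.mul_bdd (c := (∫ ω, ‖Y ω‖ ∂P) ^ 2) ?_ ?_
  · have := continuous_twistedMean hX hY
    exact Continuous.aestronglyMeasurable (by fun_prop)
  · refine Eventually.of_forall fun w => ?_
    rw [norm_pow, norm_norm]
    exact pow_le_pow_left₀ (norm_nonneg _) (norm_twistedMean_le _) 2

theorem kernelEnergy_nonneg (hk : IsFourierWeight k) (s : ℝ) : 0 ≤ kernelEnergy P k X Y s :=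
  integral_nonneg fun w => mul_nonneg (hk.pos w).le (sq_nonneg _)

theorem kernelEnergy_le (hk : IsFourierWeight k) (hX : Measurable X) (hY : Integrable Y P)
    (s : ℝ) : kernelEnergy P k X Y s ≤ (∫ ω, ‖Y ω‖ ∂P) ^ 2 := by
  calc kernelEnergy P k X Y s ≤ ∫ w, k w * (∫ ω, ‖Y ω‖ ∂P) ^ 2 := by
        refine integral_mono (integrable_kernelEnergy hk hX hY s) (hk.integrable.mul_const _) ?_
        intro w
        exact mul_le_mul_of_nonneg_left
          (pow_le_pow_left₀ (norm_nonneg _) (norm_twistedMean_le _) 2) (hk.pos w).le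
    _ = (∫ ω, ‖Y ω‖ ∂P) ^ 2 := by rw [integral_mul_const, hk.integral_eq_one, one_mul]

/-- A centered target carries no energy at small scales. -/
theorem tendsto_kernelEnergy_zero (hk : IsFourierWeight k) (hX : Measurable X)
    (hY : Integrable Y P) (hY0 : ∫ ω, Y ω ∂P = 0) :
    Tendsto (kernelEnergy P k X Y) (𝓝 0) (𝓝 0) := by
  have hc := continuous_twistedMean hX hY
  have h : Continuous (kernelEnergy P k X Y) := by
    refine continuous_of_dominated (bound := fun w => k w * (∫ ω, ‖Y ω‖ ∂P) ^ 2)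
      (fun s => (integrable_kernelEnergy hk hX hY s).aestronglyMeasurable) (fun s => ?_)
      (hk.integrable.mul_const _) ?_
    · refine Eventually.of_forall fun w => ?_
      rw [norm_mul, norm_pow, norm_norm, Real.norm_of_nonneg (hk.pos w).le]
      exact mul_le_mul_of_nonneg_left
        (pow_le_pow_left₀ (norm_nonneg _) (norm_twistedMean_le _) 2) (hk.pos w).le
    · exact Eventually.of_forall fun w => by fun_prop
  have h0 : kernelEnergy P k X Y 0 = 0 := by
    simp [kernelEnergy, twistedMean, hY0]
  simpa [h0] using h.tendsto 0

/-- Almost surely, two independent copies of a random variable without atoms differ. -/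
theorem ae_prod_ne [SFinite P] (hX : Measurable X) (hXc : ∀ x, P (X ⁻¹' {x}) = 0) :
    ∀ᵐ z ∂P.prod P, X z.1 ≠ X z.2 := by
  have hm : MeasurableSet {z : Ω × Ω | X z.1 = X z.2} :=
    measurableSet_eq_fun (hX.comp measurable_fst) (hX.comp measurable_snd)
  have : (P.prod P) {z : Ω × Ω | X z.1 = X z.2} = 0 := by
    rw [Measure.measure_prod_null hm]
    refine Eventually.of_forall fun x => ?_
    have : Prod.mk x ⁻¹' {z : Ω × Ω | X z.1 = X z.2} = X ⁻¹' {X x} := by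
      ext y
      simp [eq_comm]
    simp only [this, hXc, Pi.zero_apply]
  rw [ae_iff]
  simpa using this

theorem kernelEnergy_eq_integral_prod [SFinite P] (hk : IsFourierWeight k) (hX : Measurable X)
    (hY : Integrable Y P) (s : ℝ) :
    (kernelEnergy P k X Y s : ℂ) = ∫ z : Ω × Ω, Y z.1 * conj (Y z.2) *
      (∫ w, (Real.fourierChar (-(w * (s * (X z.1 - X z.2)))) : ℂ) * (k w : ℂ)) ∂P.prod P := by
  have hkc : Integrable fun w => (k w : ℂ) := hk.integrable.ofReal
  have hconj : Integrable (fun ω => conj (Y ω)) P :=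
    (Complex.conjLIE.integrable_comp_iff (φ := Y)).2 hY
  have hsq : ∀ w, ((k w * ‖twistedMean P X Y (s * w)‖ ^ 2 : ℝ) : ℂ)
      = ∫ z : Ω × Ω, (k w : ℂ) * (Y z.1 * conj (Y z.2)) *
          (Real.fourierChar (-(w * (s * (X z.1 - X z.2)))) : ℂ) ∂P.prod P := by
    intro w
    have h1 : ((‖twistedMean P X Y (s * w)‖ ^ 2 : ℝ) : ℂ)
        = twistedMean P X Y (s * w) * conj (twistedMean P X Y (s * w)) := by
      rw [Complex.mul_conj, Complex.normSq_eq_norm_sq]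
    rw [Complex.ofReal_mul, h1]
    unfold twistedMean
    rw [← integral_conj, ← integral_prod_mul, ← integral_const_mul]
    refine integral_congr_ae (Eventually.of_forall fun z => ?_)
    simp only [map_mul, conj_fourierChar]
    have : (Real.fourierChar (-(w * (s * (X z.1 - X z.2)))) : ℂ)
        = (Real.fourierChar (-(s * w * X z.1)) : ℂ) *
          (Real.fourierChar (- -(s * w * X z.2)) : ℂ) := by
      rw [← fourierChar_add]
      congr 3
      ring
    rw [this]
    ring
  rw [kernelEnergy, ← integral_complex_ofReal]
  simp only [hsq]
  rw [integral_integral_swap]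
  · refine integral_congr_ae (Eventually.of_forall fun z => ?_)
    simp only
    rw [← integral_const_mul]
    congr 1
    ext w
    ring
  · have h := hkc.mul_prod (hY.mul_prod hconj)
    exact integrable_mul_fourierChar (u := fun p : ℝ × Ω × Ω =>
      -(p.1 * (s * (X p.2.1 - X p.2.2)))) h (by fun_prop)

/-- Over a variable without atoms the energy also disappears at large scales: it is a double
integral of the kernel, which is a Fourier transform of `k` and thus vanishes at infinity
(Riemann-Lebesgue), off the null diagonal. -/
theorem tendsto_kernelEnergy_atTop [SFinite P] (hk : IsFourierWeight k) (hX : Measurable X)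
    (hXc : ∀ x, P (X ⁻¹' {x}) = 0) (hY : Integrable Y P) :
    Tendsto (kernelEnergy P k X Y) atTop (𝓝 0) := by
  have hkc : Integrable fun w => (k w : ℂ) := hk.integrable.ofReal
  have hconj : Integrable (fun ω => conj (Y ω)) P :=
    (Complex.conjLIE.integrable_comp_iff (φ := Y)).2 hY
  have hYY := hY.mul_prod hconj
  have hRL := Real.tendsto_integral_exp_smul_cocompact fun w => (k w : ℂ)
  simp only [Circle.smul_def, smul_eq_mul] at hRL
  set K : ℝ → ℂ := fun d => ∫ w, (Real.fourierChar (-(w * d)) : ℂ) * (k w : ℂ) with hK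
  have hKc : Continuous K := by
    refine continuous_of_dominated (bound := fun w => k w) (fun d => ?_) (fun d => ?_)
      hk.integrable ?_
    · exact (continuous_coe_fourierChar.comp (by fun_prop)).aestronglyMeasurable.mul
        hkc.aestronglyMeasurable
    · refine Eventually.of_forall fun w => ?_
      rw [norm_mul, Circle.norm_coe, one_mul, Complex.norm_real,
        Real.norm_of_nonneg (hk.pos w).le]
    · refine Eventually.of_forall fun w => Continuous.mul ?_ continuous_const
      exact continuous_coe_fourierChar.comp (by fun_prop)
  have hKb : ∀ d, ‖K d‖ ≤ 1 := fun d => by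
    refine (norm_integral_le_integral_norm _).trans (le_of_eq ?_)
    rw [← hk.integral_eq_one]
    congr 1
    ext w
    rw [norm_mul, Circle.norm_coe, one_mul, Complex.norm_real, Real.norm_of_nonneg (hk.pos w).le]
  have key : Tendsto (fun s => (kernelEnergy P k X Y s : ℂ)) atTop (𝓝 0) := by
    have h0 : (0 : ℂ) = ∫ _ : Ω × Ω, (0 : ℂ) ∂P.prod P := by simp
    rw [h0]
    simp only [kernelEnergy_eq_integral_prod hk hX hY]
    refine tendsto_integral_filter_of_dominated_convergence
      (fun z => ‖Y z.1 * conj (Y z.2)‖) (Eventually.of_forall fun s => ?_)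
      (Eventually.of_forall fun s => Eventually.of_forall fun z => ?_) hYY.norm ?_
    · exact hYY.aestronglyMeasurable.mul
        (hKc.measurable.comp (by fun_prop : Measurable fun z : Ω × Ω =>
          s * (X z.1 - X z.2))).aestronglyMeasurable
    · rw [norm_mul]
      exact mul_le_of_le_one_right (norm_nonneg _) (hKb _)
    · filter_upwards [ae_prod_ne hX hXc] with z hz
      have ht : Tendsto (fun s : ℝ => s * (X z.1 - X z.2)) atTop (cocompact ℝ) := by
        have hz' : X z.1 - X z.2 ≠ 0 := sub_ne_zero.2 hz
        have := (Homeomorph.mulRight₀ _ hz').isClosedEmbedding.tendsto_cocompact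
        exact this.comp atTop_le_cocompact
      have := (hRL.comp ht).const_mul (Y z.1 * conj (Y z.2))
      simpa using this
  have := (Complex.continuous_re.tendsto 0).comp key
  simpa [Function.comp_def] using this

end TwistedMean

/-! ### Uniqueness of the Fourier transform -/

/-- A real integrable density whose Fourier transform vanishes is zero: its positive and negative
parts are the densities of finite measures with the same characteristic function. -/
theorem ae_eq_zero_of_forall_integral_real {ν : Measure ℝ} [IsFiniteMeasure ν] {h : ℝ → ℝ}
    (hh : Integrable h ν) (h0 : ∀ t : ℝ, ∫ x, (h x : ℂ) * Complex.exp (t * x * Complex.I) ∂ν = 0) :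
    h =ᵐ[ν] 0 := by
  have hp : AEMeasurable (fun x => ENNReal.ofReal (h x)) ν := hh.aemeasurable.ennreal_ofReal
  have hn : AEMeasurable (fun x => ENNReal.ofReal (-h x)) ν := hh.aemeasurable.neg.ennreal_ofReal
  have hpf : ∫⁻ x, ENNReal.ofReal (h x) ∂ν ≠ ⊤ := hh.lintegral_lt_top.ne
  have hnf : ∫⁻ x, ENNReal.ofReal (-h x) ∂ν ≠ ⊤ := hh.neg.lintegral_lt_top.ne
  have := isFiniteMeasure_withDensity hpf
  have := isFiniteMeasure_withDensity hnf
  have hE : ∀ t : ℝ, Measurable fun x : ℝ => Complex.exp (t * x * Complex.I) := fun t => by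
    fun_prop
  have hEn : ∀ t x : ℝ, ‖Complex.exp (t * x * Complex.I)‖ = 1 := fun t x => by
    rw [← Complex.ofReal_mul, Complex.norm_exp_ofReal_mul_I]
  have hint : ∀ (u : ℝ → ℝ) (t : ℝ), Integrable u ν →
      Integrable (fun x => (u x : ℂ) * Complex.exp (t * x * Complex.I)) ν := fun u t hu =>
    hu.ofReal.mul_bdd (c := 1) (hE t).aestronglyMeasurable
      (Eventually.of_forall fun x => (hEn t x).le)
  have key : ν.withDensity (fun x => ENNReal.ofReal (h x))
      = ν.withDensity (fun x => ENNReal.ofReal (-h x)) := by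
    refine Measure.ext_of_charFun ?_
    ext t
    rw [charFun_apply_real, charFun_apply_real,
      integral_withDensity_eq_integral_toReal_smul₀ hp (Eventually.of_forall fun _ => by simp),
      integral_withDensity_eq_integral_toReal_smul₀ hn (Eventually.of_forall fun _ => by simp),
      ← sub_eq_zero]
    simp only [ENNReal.toReal_ofReal', Complex.real_smul]
    rw [← integral_sub (hint _ t hh.pos_part) (hint _ t hh.neg_part), ← h0 t]
    refine integral_congr_ae (Eventually.of_forall fun x => ?_)
    simp only
    rw [← sub_mul, ← Complex.ofReal_sub]
    congr 2
    rcases le_total 0 (h x) with hx | hx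
    · rw [max_eq_left hx, max_eq_right (by linarith)]; ring
    · rw [max_eq_right hx, max_eq_left (by linarith)]; ring
  have hae := (withDensity_eq_iff hp hn hpf).1 key
  filter_upwards [hae] with x hx
  have := congrArg ENNReal.toReal hx
  rw [ENNReal.toReal_ofReal', ENNReal.toReal_ofReal'] at this
  simp only [Pi.zero_apply]
  rcases le_total 0 (h x) with hx' | hx'
  · rw [max_eq_left hx', max_eq_right (by linarith)] at this; exact this
  · rw [max_eq_right hx', max_eq_left (by linarith)] at this; linarith

section

variable {Ω : Type*} [MeasurableSpace Ω] {P : Measure Ω} {X : Ω → ℝ} {k : ℝ → ℝ}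

/-- If all twisted means of `g(X)` vanish, then `g(X)` vanishes. The conjugate of `g` has the same
property, which reduces the claim to the real and imaginary parts. -/
theorem ae_eq_zero_of_twistedMean_eq_zero [IsFiniteMeasure P] (hX : Measurable X) {g : ℝ → ℂ}
    (hg : Measurable g) (hgi : Integrable (fun ω => g (X ω)) P)
    (h0 : ∀ t, twistedMean P X (fun ω => g (X ω)) t = 0) :
    (fun ω => g (X ω)) =ᵐ[P] 0 := by
  set ν := P.map X with hν
  have hgν : Integrable g ν :=
    (integrable_map_measure hg.aestronglyMeasurable hX.aemeasurable).2 hgi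
  have hE : ∀ t : ℝ, Measurable fun x : ℝ => Complex.exp (t * x * Complex.I) := fun t => by
    fun_prop
  have hEn : ∀ t x : ℝ, ‖Complex.exp (t * x * Complex.I)‖ = 1 := fun t x => by
    rw [← Complex.ofReal_mul, Complex.norm_exp_ofReal_mul_I]
  have h1 : ∀ t : ℝ, ∫ x, g x * Complex.exp (t * x * Complex.I) ∂ν = 0 := by
    intro t
    rw [hν, integral_map hX.aemeasurable (by fun_prop),
      ← h0 (-(t / (2 * Real.pi)))]
    refine integral_congr_ae (Eventually.of_forall fun ω => ?_)
    simp only [Real.fourierChar_apply]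
    congr 3
    rw [← Complex.ofReal_mul]
    congr 1
    field_simp
  have h2 : ∀ t : ℝ, ∫ x, conj (g x) * Complex.exp (t * x * Complex.I) ∂ν = 0 := by
    intro t
    have := congrArg conj (h1 (-t))
    rw [← integral_conj, map_zero] at this
    rw [← this]
    refine integral_congr_ae (Eventually.of_forall fun x => ?_)
    simp only [map_mul, ← Complex.exp_conj, Complex.conj_ofReal, Complex.conj_I]
    congr 2
    push_cast
    ring
  have hconj : Integrable (fun x => conj (g x)) ν :=
    (Complex.conjLIE.integrable_comp_iff (φ := g)).2 hgν
  have hb : ∀ (u : ℝ → ℂ) (t : ℝ), Integrable u ν →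
      Integrable (fun x => u x * Complex.exp (t * x * Complex.I)) ν := fun u t hu =>
    hu.mul_bdd (c := 1) (hE t).aestronglyMeasurable (Eventually.of_forall fun x => (hEn t x).le)
  have hre : (fun x => (g x).re) =ᵐ[ν] 0 := by
    refine ae_eq_zero_of_forall_integral_real hgν.re fun t => ?_
    have h3 : ∀ x, (((g x).re : ℝ) : ℂ) * Complex.exp (t * x * Complex.I)
        = (1 / 2) * (g x * Complex.exp (t * x * Complex.I)
          + conj (g x) * Complex.exp (t * x * Complex.I)) := fun x => by
      rw [← add_mul, Complex.add_conj]; push_cast; ring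
    simp only [h3]
    rw [integral_const_mul, integral_add (hb _ t hgν) (hb _ t hconj), h1, h2]
    simp
  have him : (fun x => (g x).im) =ᵐ[ν] 0 := by
    refine ae_eq_zero_of_forall_integral_real hgν.im fun t => ?_
    have h3 : ∀ x, (((g x).im : ℝ) : ℂ) * Complex.exp (t * x * Complex.I)
        = (1 / (2 * Complex.I)) * (g x * Complex.exp (t * x * Complex.I)
          - conj (g x) * Complex.exp (t * x * Complex.I)) := fun x => by
      rw [← sub_mul, Complex.sub_conj]; push_cast
      field_simp
    simp only [h3]
    rw [integral_const_mul, integral_sub (hb _ t hgν) (hb _ t hconj), h1, h2]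
    simp
  have : g =ᵐ[ν] 0 := by
    filter_upwards [hre, him] with x hx hx'
    exact Complex.ext hx hx'
  exact ae_of_ae_map hX.aemeasurable this

/-- A nonzero target that is a function of `X` has positive energy at every positive scale. -/
theorem kernelEnergy_pos [IsFiniteMeasure P] (hk : IsFourierWeight k) (hX : Measurable X)
    {g : ℝ → ℂ} (hg : Measurable g) (hgi : Integrable (fun ω => g (X ω)) P)
    (hgpos : 0 < ∫ ω, ‖g (X ω)‖ ^ 2 ∂P) {s : ℝ} (hs : 0 < s) :
    0 < kernelEnergy P k X (fun ω => g (X ω)) s := by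
  set F := fun w => twistedMean P X (fun ω => g (X ω)) (s * w) with hF
  have hFc : Continuous F := (continuous_twistedMean hX hgi).comp (by fun_prop)
  have hne : ∃ w, F w ≠ 0 := by
    by_contra! hall
    have h := ae_eq_zero_of_twistedMean_eq_zero hX hg hgi fun t => by
      have := hall (t / s)
      simpa only [hF, mul_div_cancel₀ t hs.ne'] using this
    have : ∫ ω, ‖g (X ω)‖ ^ 2 ∂P = 0 := by
      rw [integral_eq_zero_of_ae]
      filter_upwards [h] with ω hω
      simp only [hω, Pi.zero_apply, norm_zero]
      norm_num
    exact hgpos.ne' this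
  unfold kernelEnergy
  rw [integral_pos_iff_support_of_nonneg (fun w => mul_nonneg (hk.pos w).le (sq_nonneg _))
    (integrable_kernelEnergy hk hX hgi s)]
  have hsupp : (Function.support fun w => k w * ‖twistedMean P X (fun ω => g (X ω)) (s * w)‖ ^ 2)
      = F ⁻¹' {0}ᶜ := by
    ext w
    simp [hF, (hk.pos w).ne']
  rw [hsupp]
  obtain ⟨w, hw⟩ := hne
  exact (isOpen_compl_singleton.preimage hFc).measure_pos _ ⟨w, hw⟩

end

/-! ### Evaluation in the Hilbert space -/

section RKHS

variable {k : ℝ → ℝ}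

theorem RKHS.normSq_nonneg (hk : IsFourierWeight k) (f : RKHS k) : 0 ≤ f.normSq :=
  integral_nonneg fun w => div_nonneg (sq_nonneg _) (hk.pos w).le

theorem RKHS.toFun_eq (f : RKHS k) (x : ℝ) :
    f.toFun x = ∫ w, f.ft w * (Real.fourierChar (x * w) : ℂ) := by
  rw [f.inversion]
  simp only [exp_eq_fourierChar]

theorem RKHS.integrable_ft_mul (f : RKHS k) (x : ℝ) :
    Integrable fun w => f.ft w * (Real.fourierChar (x * w) : ℂ) :=
  integrable_mul_fourierChar f.integrable_ft (by fun_prop)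

/-- The Cauchy-Schwarz inequality for the dual weights `1 / k` and `k`. -/
theorem RKHS.sq_integral_norm_ft_mul_le (hk : IsFourierWeight k) (f : RKHS k) {ρ : ℝ → ℝ}
    (hρ : Continuous ρ) {M : ℝ} (hM : ∀ w, |ρ w| ≤ M) :
    (∫ w, ‖f.ft w‖ * ρ w) ^ 2 ≤ f.normSq * ∫ w, k w * ρ w ^ 2 := by
  have h1 : Integrable fun w => ‖f.ft w‖ * ρ w :=
    f.integrable_ft.norm.mul_bdd (c := M) hρ.aestronglyMeasurable (Eventually.of_forall hM)
  have h2 : Integrable fun w => k w * ρ w ^ 2 := by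
    refine hk.integrable.mul_bdd (c := M ^ 2) (by fun_prop) (Eventually.of_forall fun w => ?_)
    rw [norm_pow]
    exact pow_le_pow_left₀ (norm_nonneg _) (hM w) 2
  have hq : ∀ c : ℝ, 0 ≤ (∫ w, k w * ρ w ^ 2) * (c * c) + (-2 * ∫ w, ‖f.ft w‖ * ρ w) * c
      + f.normSq := by
    intro c
    have hpt : ∀ w, 0 ≤ (k w * ρ w ^ 2) * (c * c) + (-2 * c) * (‖f.ft w‖ * ρ w)
        + ‖f.ft w‖ ^ 2 / k w := by
      intro w
      have hkw := hk.pos w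
      have : (k w * ρ w ^ 2) * (c * c) + (-2 * c) * (‖f.ft w‖ * ρ w) + ‖f.ft w‖ ^ 2 / k w
          = (k w * (ρ w * c) - ‖f.ft w‖) ^ 2 / k w := by
        field_simp
        ring
      rw [this]
      positivity
    have h3 := integral_nonneg (μ := volume) (f := fun w => (k w * ρ w ^ 2) * (c * c)
      + (-2 * c) * (‖f.ft w‖ * ρ w) + ‖f.ft w‖ ^ 2 / k w) hpt
    have h4 : Integrable fun w => (k w * ρ w ^ 2) * (c * c) + (-2 * c) * (‖f.ft w‖ * ρ w) :=
      (h2.mul_const _).add (h1.const_mul _)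
    rw [integral_add h4 f.integrable_sq, integral_add (h2.mul_const _) (h1.const_mul _),
      integral_mul_const, integral_const_mul] at h3
    unfold RKHS.normSq
    linarith
  have := discrim_le_zero hq
  rw [discrim] at this
  nlinarith

theorem RKHS.norm_sq_le (hk : IsFourierWeight k) (f : RKHS k) (x : ℝ) :
    ‖f.toFun x‖ ^ 2 ≤ f.normSq := by
  have h := f.sq_integral_norm_ft_mul_le hk (ρ := fun _ => 1) continuous_const (M := 1) (by simp)
  simp only [mul_one, one_pow, hk.integral_eq_one] at h
  refine le_trans (pow_le_pow_left₀ (norm_nonneg _) ?_ 2) h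
  rw [f.toFun_eq]
  refine (norm_integral_le_integral_norm _).trans (le_of_eq ?_)
  simp [Circle.norm_coe]

/-- The squared distance `‖K(·, d) - K(·, 0)‖²` of two evaluation functionals at distance `d`. -/
noncomputable def evalDistSq (k : ℝ → ℝ) (d : ℝ) : ℝ :=
  ∫ w, k w * ‖(Real.fourierChar (d * w) : ℂ) - 1‖ ^ 2

theorem norm_fourierChar_sub_one_sq_le (x : ℝ) : ‖(Real.fourierChar x : ℂ) - 1‖ ^ 2 ≤ 4 := by
  have := pow_le_pow_left₀ (norm_nonneg _) (norm_fourierChar_sub_one_le x) 2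
  norm_num at this
  exact this

theorem evalDistSq_nonneg (hk : IsFourierWeight k) (d : ℝ) : 0 ≤ evalDistSq k d :=
  integral_nonneg fun w => mul_nonneg (hk.pos w).le (sq_nonneg _)

theorem continuous_norm_fourierChar_sub_one :
    Continuous fun x : ℝ => ‖(Real.fourierChar x : ℂ) - 1‖ :=
  (continuous_coe_fourierChar.sub continuous_const).norm

theorem norm_evalDistSq_integrand_le (hk : IsFourierWeight k) (d w : ℝ) :
    ‖k w * ‖(Real.fourierChar (d * w) : ℂ) - 1‖ ^ 2‖ ≤ k w * 4 := by
  rw [Real.norm_of_nonneg (mul_nonneg (hk.pos w).le (sq_nonneg _))]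
  exact mul_le_mul_of_nonneg_left (norm_fourierChar_sub_one_sq_le _) (hk.pos w).le

theorem evalDistSq_le (hk : IsFourierWeight k) (d : ℝ) : ‖evalDistSq k d‖ ≤ 4 := by
  refine (norm_integral_le_of_norm_le (hk.integrable.mul_const 4)
    (Eventually.of_forall (norm_evalDistSq_integrand_le hk d))).trans (le_of_eq ?_)
  rw [integral_mul_const, hk.integral_eq_one, one_mul]

theorem continuous_evalDistSq (hk : IsFourierWeight k) : Continuous (evalDistSq k) := by
  have hc := continuous_norm_fourierChar_sub_one
  refine continuous_of_dominated (bound := fun w => k w * 4) (fun d => ?_)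
    (fun d => Eventually.of_forall (norm_evalDistSq_integrand_le hk d))
    (hk.integrable.mul_const _) (Eventually.of_forall fun w => ?_)
  · exact hk.integrable.aestronglyMeasurable.mul
      ((hc.comp (by fun_prop : Continuous fun w => d * w)).pow 2).aestronglyMeasurable
  · exact continuous_const.mul ((hc.comp (by fun_prop : Continuous fun d => d * w)).pow 2)

theorem evalDistSq_zero : evalDistSq k 0 = 0 := by
  simp [evalDistSq]

theorem RKHS.norm_sub_sq_le (hk : IsFourierWeight k) (f : RKHS k) (x y : ℝ) :
    ‖f.toFun x - f.toFun y‖ ^ 2 ≤ f.normSq * evalDistSq k (x - y) := by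
  have h := f.sq_integral_norm_ft_mul_le hk
    (ρ := fun w => ‖(Real.fourierChar ((x - y) * w) : ℂ) - 1‖)
    (continuous_norm_fourierChar_sub_one.comp (by fun_prop)) (M := 2) fun w => by
      rw [abs_norm]
      exact norm_fourierChar_sub_one_le _
  refine le_trans (pow_le_pow_left₀ (norm_nonneg _) ?_ 2) h
  rw [f.toFun_eq, f.toFun_eq, ← integral_sub (f.integrable_ft_mul x) (f.integrable_ft_mul y)]
  refine (norm_integral_le_integral_norm _).trans (le_of_eq ?_)
  congr 1
  ext w
  rw [← mul_sub, norm_mul, norm_fourierChar_sub, sub_mul]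

theorem RKHS.continuous (f : RKHS k) : Continuous f.toFun := by
  have h : f.toFun = fun x => ∫ w, f.ft w * (Real.fourierChar (x * w) : ℂ) := funext f.toFun_eq
  rw [h]
  refine continuous_of_dominated (bound := fun w => ‖f.ft w‖)
    (fun x => (f.integrable_ft_mul x).aestronglyMeasurable)
    (fun x => Eventually.of_forall fun w => by simp [Circle.norm_coe])
    f.integrable_ft.norm (Eventually.of_forall fun w => ?_)
  exact continuous_const.mul (continuous_coe_fourierChar.comp (by fun_prop))

end RKHS

/-! ### Two-sided bounds for the minimal loss -/

section Loss

variable {Ω : Type*} [MeasurableSpace Ω] {P : Measure Ω} {X : Ω → ℝ} {Y : Ω → ℂ} {k : ℝ → ℝ}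
  {lam : ℝ}

theorem RKHS.memLp_comp [IsFiniteMeasure P] (hk : IsFourierWeight k) (hX : Measurable X)
    (f : RKHS k) (U : ℝ) : MemLp (fun ω => f.toFun (U * X ω)) 2 P := by
  refine MemLp.of_bound (C := Real.sqrt f.normSq)
    (f.continuous.measurable.comp (hX.const_mul U)).aestronglyMeasurable
    (Eventually.of_forall fun ω => ?_)
  exact Real.le_sqrt_of_sq_le (f.norm_sq_le hk _)

theorem integral_conj_mul_comp [SFinite P] (hX : Measurable X) (hY : Integrable Y P)
    (f : RKHS k) (U : ℝ) :
    ∫ ω, conj (Y ω) * f.toFun (U * X ω) ∂P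
      = ∫ w, f.ft w * conj (twistedMean P X Y (U * w)) := by
  have hconj : Integrable (fun ω => conj (Y ω)) P :=
    (Complex.conjLIE.integrable_comp_iff (φ := Y)).2 hY
  have hint := integrable_mul_fourierChar (u := fun p : Ω × ℝ => U * X p.1 * p.2)
    (hconj.mul_prod f.integrable_ft) (by fun_prop)
  calc ∫ ω, conj (Y ω) * f.toFun (U * X ω) ∂P
      = ∫ ω, (∫ w, conj (Y ω) * f.ft w * (Real.fourierChar (U * X ω * w) : ℂ)) ∂P := by
        refine integral_congr_ae (Eventually.of_forall fun ω => ?_)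
        simp only
        rw [f.toFun_eq, ← integral_const_mul]
        simp only [mul_assoc]
    _ = ∫ w, ∫ ω, conj (Y ω) * f.ft w * (Real.fourierChar (U * X ω * w) : ℂ) ∂P :=
        integral_integral_swap hint
    _ = ∫ w, f.ft w * conj (twistedMean P X Y (U * w)) := by
        refine integral_congr_ae (Eventually.of_forall fun w => ?_)
        simp only [twistedMean]
        rw [← integral_conj, ← integral_const_mul]
        refine integral_congr_ae (Eventually.of_forall fun ω => ?_)
        simp only [map_mul, conj_fourierChar, neg_neg]
        rw [mul_right_comm U (X ω) w]
        ring

theorem loss_eq [IsProbabilityMeasure P] (hk : IsFourierWeight k) (hX : Measurable X)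
    (hY : MemLp Y 2 P) (f : RKHS k) (U : ℝ) :
    loss P k lam X Y f U = 1 / 2 * ∫ ω, ‖Y ω‖ ^ 2 ∂P
      - (∫ w, f.ft w * conj (twistedMean P X Y (U * w))).re
      + 1 / 2 * ∫ ω, ‖f.toFun (U * X ω)‖ ^ 2 ∂P + lam / 2 * f.normSq := by
  have hf := f.memLp_comp hk hX U (P := P)
  have hfi : Integrable (fun ω => ‖f.toFun (U * X ω)‖ ^ 2) P := hf.integrable_norm_pow (by norm_num)
  have hYi : Integrable (fun ω => ‖Y ω‖ ^ 2) P := hY.integrable_norm_pow (by norm_num)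
  have hcr : Integrable (fun ω => conj (Y ω) * f.toFun (U * X ω)) P :=
    hY.star.integrable_mul hf
  have hpt : ∀ ω, ‖Y ω - f.toFun (U * X ω)‖ ^ 2
      = ‖Y ω‖ ^ 2 + ‖f.toFun (U * X ω)‖ ^ 2 - 2 * (conj (Y ω) * f.toFun (U * X ω)).re := by
    intro ω
    rw [← Complex.normSq_eq_norm_sq, Complex.normSq_sub, Complex.normSq_eq_norm_sq,
      Complex.normSq_eq_norm_sq]
    congr 2
    simp
  rw [← integral_conj_mul_comp hX (hY.integrable (by norm_num)) f U, loss]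
  have hcr2 : Integrable (fun ω => 2 * (conj (Y ω) * f.toFun (U * X ω)).re) P :=
    hcr.re.const_mul 2
  have hadd : Integrable (fun ω => ‖Y ω‖ ^ 2 + ‖f.toFun (U * X ω)‖ ^ 2) P := hYi.add hfi
  simp only [hpt]
  rw [integral_sub hadd hcr2, integral_add hYi hfi, integral_const_mul]
  have : ∫ ω, (conj (Y ω) * f.toFun (U * X ω)).re ∂P
      = (∫ ω, conj (Y ω) * f.toFun (U * X ω) ∂P).re := integral_re hcr
  rw [this]
  ring

theorem loss_nonneg (hk : IsFourierWeight k) (hlam : 0 < lam) (f : RKHS k) (U : ℝ) :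
    0 ≤ loss P k lam X Y f U := by
  have := f.normSq_nonneg hk
  have h2 : 0 ≤ ∫ ω, ‖Y ω - f.toFun (U * X ω)‖ ^ 2 ∂P := integral_nonneg fun _ => sq_nonneg _
  unfold loss
  positivity

theorem bddBelow_loss (hk : IsFourierWeight k) (hlam : 0 < lam) (U : ℝ) :
    BddBelow (Set.range fun f : RKHS k => loss P k lam X Y f U) :=
  ⟨0, by rintro _ ⟨f, rfl⟩; exact loss_nonneg hk hlam f U⟩

theorem minLoss_le_loss (hk : IsFourierWeight k) (hlam : 0 < lam) (f : RKHS k) (U : ℝ) :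
    minLoss P k lam X Y U ≤ loss P k lam X Y f U :=
  ciInf_le (bddBelow_loss hk hlam U) f

/-- Dropping `E|f(UX)|² ≥ 0`, the loss is bounded below by a quadratic functional of `f` whose
minimum is explicit. -/
theorem le_minLoss [IsProbabilityMeasure P] (hk : IsFourierWeight k) (hlam : 0 < lam)
    (hX : Measurable X) (hY : MemLp Y 2 P) (U : ℝ) :
    1 / 2 * ∫ ω, ‖Y ω‖ ^ 2 ∂P - kernelEnergy P k X Y U / (2 * lam) ≤ minLoss P k lam X Y U := by
  refine le_ciInf fun f => ?_
  rw [loss_eq hk hX hY]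
  have hYi := hY.integrable (μ := P) (by norm_num)
  have hpos : 0 ≤ ∫ ω, ‖f.toFun (U * X ω)‖ ^ 2 ∂P := integral_nonneg fun _ => sq_nonneg _
  have hE := integrable_kernelEnergy hk hX hYi U
  have hre : (∫ w, f.ft w * conj (twistedMean P X Y (U * w))).re
      ≤ lam / 2 * f.normSq + kernelEnergy P k X Y U / (2 * lam) := by
    refine (Complex.re_le_norm _).trans ?_
    have hdom := (f.integrable_sq.const_mul (lam / 2)).add (hE.const_mul (1 / (2 * lam)))
    refine (norm_integral_le_of_norm_le hdom (Eventually.of_forall fun w => ?_)).trans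
      (le_of_eq ?_)
    · have hkw := hk.pos w
      simp only [norm_mul, RCLike.norm_conj, Pi.add_apply]
      set A := ‖f.ft w‖
      set B := ‖twistedMean P X Y (U * w)‖
      have : lam / 2 * (A ^ 2 / k w) + 1 / (2 * lam) * (k w * B ^ 2) - A * B
          = (lam * A - k w * B) ^ 2 / (2 * lam * k w) := by
        field_simp
        ring
      have h2 : 0 ≤ (lam * A - k w * B) ^ 2 / (2 * lam * k w) := by positivity
      linarith
    · simp only [Pi.add_apply]
      rw [integral_add (f.integrable_sq.const_mul (lam / 2)) (hE.const_mul (1 / (2 * lam))),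
        integral_const_mul, integral_const_mul, RKHS.normSq, kernelEnergy]
      ring
  linarith

/-- The multiple `c E[Y K(·, UX)]` of the correlation of the target with the kernel, as an
element of the Hilbert space. -/
noncomputable def correlator (hk : IsFourierWeight k) (hX : Measurable X) (hY : Integrable Y P)
    (U c : ℝ) : RKHS k where
  toFun := fun x => ∫ w, ((c * k w : ℝ) : ℂ) * twistedMean P X Y (U * w) *
    Complex.exp (2 * Real.pi * Complex.I * x * w)
  ft := fun w => ((c * k w : ℝ) : ℂ) * twistedMean P X Y (U * w)
  integrable_ft := by
    have := continuous_twistedMean hX hY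
    refine ((hk.integrable.const_mul c).ofReal).mul_bdd (c := ∫ ω, ‖Y ω‖ ∂P) ?_
      (Eventually.of_forall fun w => norm_twistedMean_le _)
    exact Continuous.aestronglyMeasurable (by fun_prop)
  integrable_sq := by
    refine ((integrable_kernelEnergy hk hX hY U).const_mul (c ^ 2)).congr
      (Eventually.of_forall fun w => ?_)
    have := (hk.pos w).ne'
    simp only [norm_mul, Complex.norm_real, mul_pow, Real.norm_eq_abs, sq_abs]
    field_simp
  inversion := fun _ => rfl

theorem normSq_correlator (hk : IsFourierWeight k) (hX : Measurable X) (hY : Integrable Y P)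
    (U c : ℝ) : (correlator hk hX hY U c).normSq = c ^ 2 * kernelEnergy P k X Y U := by
  rw [RKHS.normSq, kernelEnergy, ← integral_const_mul]
  refine integral_congr_ae (Eventually.of_forall fun w => ?_)
  have := (hk.pos w).ne'
  simp only [correlator, norm_mul, Complex.norm_real, mul_pow, Real.norm_eq_abs, sq_abs]
  field_simp

theorem minLoss_le [IsProbabilityMeasure P] (hk : IsFourierWeight k) (hlam : 0 < lam)
    (hX : Measurable X) (hY : MemLp Y 2 P) (U : ℝ) :
    minLoss P k lam X Y U
      ≤ 1 / 2 * ∫ ω, ‖Y ω‖ ^ 2 ∂P - kernelEnergy P k X Y U / (2 * (1 + lam)) := by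
  have hYi := hY.integrable (μ := P) (by norm_num)
  -- Since evaluations have norm one, `E|f(UX)|² ≤ ‖f‖²`; the constant is optimal for the
  -- resulting quadratic upper bound.
  set c : ℝ := 1 / (1 + lam) with hc
  set f := correlator hk hX hYi U c with hf
  refine (minLoss_le_loss hk hlam f U).trans ?_
  rw [loss_eq hk hX hY]
  have hns : f.normSq = c ^ 2 * kernelEnergy P k X Y U := normSq_correlator hk hX hYi U c
  have h1 : ∫ ω, ‖f.toFun (U * X ω)‖ ^ 2 ∂P ≤ f.normSq := by
    calc ∫ ω, ‖f.toFun (U * X ω)‖ ^ 2 ∂P ≤ ∫ _, f.normSq ∂P :=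
          integral_mono ((f.memLp_comp hk hX U).integrable_norm_pow (by norm_num))
            (integrable_const _) fun ω => f.norm_sq_le hk _
      _ = f.normSq := by simp
  have h2 : (∫ w, f.ft w * conj (twistedMean P X Y (U * w))).re = c * kernelEnergy P k X Y U := by
    have : ∀ w, f.ft w * conj (twistedMean P X Y (U * w))
        = ((c * (k w * ‖twistedMean P X Y (U * w)‖ ^ 2) : ℝ) : ℂ) := by
      intro w
      simp only [hf, correlator]
      rw [mul_assoc, Complex.mul_conj, Complex.normSq_eq_norm_sq]
      push_cast
      ring
    simp only [this]
    rw [integral_complex_ofReal, Complex.ofReal_re, integral_const_mul, kernelEnergy]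
  rw [h2]
  have h3 : -(c * kernelEnergy P k X Y U) + (1 + lam) / 2 * (c ^ 2 * kernelEnergy P k X Y U)
      = - (kernelEnergy P k X Y U / (2 * (1 + lam))) := by
    rw [hc]
    field_simp
    ring
  rw [hns] at h1 ⊢
  linarith

theorem minLoss_nonneg (hk : IsFourierWeight k) (hlam : 0 < lam) (U : ℝ) :
    0 ≤ minLoss P k lam X Y U :=
  le_ciInf fun f => loss_nonneg hk hlam f U

theorem minLoss_le_half [IsProbabilityMeasure P] (hk : IsFourierWeight k) (hlam : 0 < lam)
    (hX : Measurable X) (hY : MemLp Y 2 P) (U : ℝ) :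
    minLoss P k lam X Y U ≤ 1 / 2 * ∫ ω, ‖Y ω‖ ^ 2 ∂P := by
  have h := minLoss_le hk hlam hX hY U
  have : 0 ≤ kernelEnergy P k X Y U / (2 * (1 + lam)) :=
    div_nonneg (kernelEnergy_nonneg hk U) (by positivity)
  linarith

end Loss

/-! ### Semicontinuity of the minimal loss -/

section Semicontinuity

variable {Ω : Type*} [MeasurableSpace Ω] {P : Measure Ω} {X : Ω → ℝ} {Y : Ω → ℂ} {k : ℝ → ℝ}
  {lam : ℝ}

theorem integrable_evalDistSq_comp [IsFiniteMeasure P] (hk : IsFourierWeight k)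
    (hX : Measurable X) (u : ℝ) : Integrable (fun ω => evalDistSq k (u * X ω)) P :=
  Integrable.of_bound
    ((continuous_evalDistSq hk).measurable.comp (hX.const_mul u)).aestronglyMeasurable 4
    (Eventually.of_forall fun _ => evalDistSq_le hk _)

theorem tendsto_integral_evalDistSq [IsFiniteMeasure P] (hk : IsFourierWeight k)
    (hX : Measurable X) :
    Tendsto (fun u => ∫ ω, evalDistSq k (u * X ω) ∂P) (𝓝 0) (𝓝 0) := by
  have h : Continuous fun u => ∫ ω, evalDistSq k (u * X ω) ∂P :=
    continuous_of_dominated (bound := fun _ => 4)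
      (fun u => (integrable_evalDistSq_comp hk hX u).aestronglyMeasurable)
      (fun u => Eventually.of_forall fun ω => evalDistSq_le hk _) (integrable_const _)
      (Eventually.of_forall fun ω => (continuous_evalDistSq hk).comp (by fun_prop))
  have := h.tendsto 0
  simpa [evalDistSq_zero] using this

/-- The loss of a fixed `f` changes with `U` by a factor that is close to one, uniformly in `f`. -/
theorem loss_le_mul_loss [IsProbabilityMeasure P] (hk : IsFourierWeight k) (hlam : 0 < lam)
    (hX : Measurable X) (hY : MemLp Y 2 P) (f : RKHS k) (U V : ℝ) {t : ℝ} (ht : 0 < t) :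
    loss P k lam X Y f U
      ≤ (1 + t + (1 + 1 / t) * (∫ ω, evalDistSq k ((U - V) * X ω) ∂P) / lam)
        * loss P k lam X Y f V := by
  set D := ∫ ω, evalDistSq k ((U - V) * X ω) ∂P with hD
  have hD0 : 0 ≤ D := integral_nonneg fun _ => evalDistSq_nonneg hk _
  have hU : Integrable (fun ω => ‖Y ω - f.toFun (U * X ω)‖ ^ 2) P :=
    (hY.sub (f.memLp_comp hk hX U)).integrable_norm_pow (by norm_num)
  have hV : Integrable (fun ω => ‖Y ω - f.toFun (V * X ω)‖ ^ 2) P :=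
    (hY.sub (f.memLp_comp hk hX V)).integrable_norm_pow (by norm_num)
  have hdi := integrable_evalDistSq_comp (P := P) hk hX (U - V)
  have hN := f.normSq_nonneg hk
  have hpt : ∀ ω, ‖Y ω - f.toFun (U * X ω)‖ ^ 2 ≤ (1 + t) * ‖Y ω - f.toFun (V * X ω)‖ ^ 2
      + ((1 + 1 / t) * f.normSq) * evalDistSq k ((U - V) * X ω) := by
    intro ω
    have h1 := f.norm_sub_sq_le hk (V * X ω) (U * X ω)
    have hsymm : evalDistSq k (V * X ω - U * X ω) = evalDistSq k ((U - V) * X ω) := by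
      unfold evalDistSq
      congr 1
      ext w
      congr 2
      have h := norm_fourierChar_sub ((V * X ω - U * X ω) * w) 0
      have h' := norm_fourierChar_sub 0 ((V * X ω - U * X ω) * w)
      rw [norm_sub_rev, h, sub_zero, zero_sub] at h'
      rw [h']
      congr 4
      ring
    rw [hsymm] at h1
    have h2 : ‖Y ω - f.toFun (U * X ω)‖
        ≤ ‖Y ω - f.toFun (V * X ω)‖ + ‖f.toFun (V * X ω) - f.toFun (U * X ω)‖ :=
      norm_sub_le_norm_sub_add_norm_sub _ _ _
    set A := ‖Y ω - f.toFun (V * X ω)‖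
    set B := ‖f.toFun (V * X ω) - f.toFun (U * X ω)‖
    have h3 : ‖Y ω - f.toFun (U * X ω)‖ ^ 2 ≤ (A + B) ^ 2 :=
      pow_le_pow_left₀ (norm_nonneg _) h2 2
    have h4 : (1 + t) * A ^ 2 + (1 + 1 / t) * B ^ 2 - (A + B) ^ 2 = (t * A - B) ^ 2 / t := by
      field_simp
      ring
    have h5 : 0 ≤ (t * A - B) ^ 2 / t := by positivity
    have h6 : (1 + 1 / t) * B ^ 2
        ≤ (1 + 1 / t) * (f.normSq * evalDistSq k ((U - V) * X ω)) :=
      mul_le_mul_of_nonneg_left h1 (by positivity)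
    linarith
  have hint : ∫ ω, ‖Y ω - f.toFun (U * X ω)‖ ^ 2 ∂P
      ≤ (1 + t) * (∫ ω, ‖Y ω - f.toFun (V * X ω)‖ ^ 2 ∂P) + (1 + 1 / t) * f.normSq * D := by
    rw [hD, ← integral_const_mul, ← integral_const_mul,
      ← integral_add (hV.const_mul _) (hdi.const_mul _)]
    exact integral_mono hU ((hV.const_mul _).add (hdi.const_mul _)) hpt
  have hI : 0 ≤ ∫ ω, ‖Y ω - f.toFun (V * X ω)‖ ^ 2 ∂P := integral_nonneg fun _ => sq_nonneg _
  unfold loss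
  set I := ∫ ω, ‖Y ω - f.toFun (V * X ω)‖ ^ 2 ∂P
  set N := f.normSq
  have hexp : (1 + t + (1 + 1 / t) * D / lam) * (1 / 2 * I + lam / 2 * N)
      = 1 / 2 * ((1 + t) * I + (1 + 1 / t) * N * D) + lam / 2 * N
        + (t * (lam / 2 * N) + (1 + 1 / t) * D / lam * (1 / 2 * I)) := by
    field_simp
    ring
  rw [hexp]
  have : 0 ≤ t * (lam / 2 * N) + (1 + 1 / t) * D / lam * (1 / 2 * I) := by positivity
  linarith

theorem minLoss_le_mul_minLoss [IsProbabilityMeasure P] (hk : IsFourierWeight k) (hlam : 0 < lam)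
    (hX : Measurable X) (hY : MemLp Y 2 P) (U V : ℝ) {t : ℝ} (ht : 0 < t) :
    minLoss P k lam X Y U
      ≤ (1 + t + (1 + 1 / t) * (∫ ω, evalDistSq k ((U - V) * X ω) ∂P) / lam)
        * minLoss P k lam X Y V := by
  have hD0 : 0 ≤ ∫ ω, evalDistSq k ((U - V) * X ω) ∂P :=
    integral_nonneg fun _ => evalDistSq_nonneg hk _
  conv_rhs => rw [minLoss]
  rw [Real.mul_iInf_of_nonneg (by positivity)]
  exact le_ciInf fun f => (minLoss_le_loss hk hlam f U).trans
    (loss_le_mul_loss hk hlam hX hY f U V ht)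

theorem lowerSemicontinuous_minLoss [IsProbabilityMeasure P] (hk : IsFourierWeight k)
    (hlam : 0 < lam) (hX : Measurable X) (hY : MemLp Y 2 P) :
    LowerSemicontinuous (minLoss P k lam X Y) := by
  intro U y hy
  set B := 1 / 2 * ∫ ω, ‖Y ω‖ ^ 2 ∂P with hB
  have hB0 : 0 ≤ B := mul_nonneg (by norm_num) (integral_nonneg fun _ => sq_nonneg _)
  set d := minLoss P k lam X Y U - y with hd
  have hd0 : 0 < d := sub_pos.2 hy
  -- `minLoss ≤ B` turns the factor `1 + 2t` into an additive error `2tB < d`.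
  set t := d / (4 * (B + 1)) with htdef
  have ht : 0 < t := by positivity
  have hlim : Tendsto (fun V => (1 + 1 / t) * (∫ ω, evalDistSq k ((U - V) * X ω) ∂P) / lam)
      (𝓝 U) (𝓝 0) := by
    have h1 : Tendsto (fun V : ℝ => U - V) (𝓝 U) (𝓝 0) := by
      have h := (by fun_prop : Continuous fun V : ℝ => U - V).tendsto U
      rwa [sub_self] at h
    have h2 := (((tendsto_integral_evalDistSq (P := P) hk hX).comp h1).const_mul
      (1 + 1 / t)).div_const lam
    simpa using h2
  filter_upwards [hlim.eventually (gt_mem_nhds ht)] with V hV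
  have h1 := minLoss_le_mul_minLoss hk hlam hX hY U V ht
  have h2 := minLoss_le_half hk hlam hX hY V
  have h3 := minLoss_nonneg (P := P) (X := X) (Y := Y) hk hlam V
  set E := (1 + 1 / t) * (∫ ω, evalDistSq k ((U - V) * X ω) ∂P) / lam
  have h4 : (t + E) * minLoss P k lam X Y V ≤ (t + t) * B :=
    mul_le_mul (by linarith) h2 h3 (by linarith)
  have h5 : (t + t) * B < d := by
    have : t * (4 * (B + 1)) = d := by rw [htdef]; field_simp
    nlinarith
  have h6 : (1 + t + E) * minLoss P k lam X Y V
      = minLoss P k lam X Y V + (t + E) * minLoss P k lam X Y V := by ring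
  linarith

theorem lowerSemicontinuous_calJ [IsProbabilityMeasure P] (hk : IsFourierWeight k)
    (hlam : 0 < lam) (hX : Measurable X) (hY : MemLp Y 2 P) :
    LowerSemicontinuous (calJ P k lam X Y) :=
  LowerSemicontinuous.comp (lowerSemicontinuous_minLoss hk hlam hX hY) Real.continuous_sqrt

end Semicontinuity

/-! ### Neighbourhoods of scales and detectors -/

theorem scaleNhd_eq_Icc {S L : ℝ} (hS : 0 < S) (hL : 1 < L) :
    scaleNhd S L = Set.Icc (L⁻¹ * S) (L * S) := by
  ext S'
  simp only [scaleNhd, Set.mem_ofPred_eq, Set.mem_Icc]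
  refine ⟨fun h => h.2, fun h => ⟨lt_of_lt_of_le ?_ h.1, h⟩⟩
  have : 0 < L := by linarith
  positivity

theorem inv_mul_lt_mul {S L : ℝ} (hS : 0 < S) (hL : 1 < L) : L⁻¹ * S < L * S := by
  have h : L⁻¹ < 1 := inv_lt_one_of_one_lt₀ hL
  nlinarith

theorem frontier_scaleNhd {S L : ℝ} (hS : 0 < S) (hL : 1 < L) :
    frontier (scaleNhd S L) = {L⁻¹ * S, L * S} := by
  rw [scaleNhd_eq_Icc hS hL, frontier_Icc (inv_mul_lt_mul hS hL).le]

section Detectors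

variable {Ω : Type*} [MeasurableSpace Ω] {P : Measure Ω} {X : Ω → ℝ} {Y : Ω → ℂ} {k : ℝ → ℝ}
  {lam : ℝ}

/-- Where `𝓙` is within less than the gap of its upper bound `½ E|Y|²` there is no detector. -/
theorem not_isScaleDetector [IsProbabilityMeasure P] (hk : IsFourierWeight k) (hlam : 0 < lam)
    (hX : Measurable X) (hY : MemLp Y 2 P) {e L S : ℝ} (hL : 1 < L)
    (h : 1 / 2 * ∫ ω, ‖Y ω‖ ^ 2 ∂P < calJ P k lam X Y S + e * ∫ ω, ‖Y ω‖ ^ 2 ∂P) :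
    ¬ IsScaleDetector P k lam X Y e L S := by
  intro hS
  have h1 := hS.gap (L * S) (by rw [frontier_scaleNhd hS.pos hL]; simp)
  have h2 : calJ P k lam X Y (L * S) ≤ _ := minLoss_le_half hk hlam hX hY _
  linarith

/-- If `𝓙` has a dip at `T` and stays high on the `L³`-neighbourhood of `T` outside its
`L`-neighbourhood, then a minimizer over the latter is an `L²`-scale detector. -/
theorem exists_isScaleDetector [IsProbabilityMeasure P] (hk : IsFourierWeight k) (hlam : 0 < lam)
    (hX : Measurable X) (hY : MemLp Y 2 P) {e L T b : ℝ} (hL : 1 < L) (hT : 0 < T)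
    (hdip : calJ P k lam X Y T < b)
    (hgap : calJ P k lam X Y T + e * ∫ ω, ‖Y ω‖ ^ 2 ∂P ≤ b)
    (hout : ∀ S, L⁻¹ ^ 3 * T ≤ S → S ≤ L ^ 3 * T → (S ≤ L⁻¹ * T ∨ L * T ≤ S) →
      b ≤ calJ P k lam X Y S) :
    ∃ S, IsScaleDetector P k lam X Y e (L ^ 2) S ∧ L⁻¹ * T < S ∧ S < L * T := by
  have hL0 : 0 < L := by linarith
  have hi0 : 0 < L⁻¹ := inv_pos.2 hL0
  have hi1 : L⁻¹ < 1 := inv_lt_one_of_one_lt₀ hL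
  have hLi : L * L⁻¹ = 1 := mul_inv_cancel₀ hL0.ne'
  have hi3 : L⁻¹ ^ 3 ≤ L⁻¹ := pow_le_of_le_one hi0.le hi1.le (by norm_num)
  have hL3 : L ≤ L ^ 3 := le_self_pow₀ hL.le (by norm_num)
  have hTmem : T ∈ Set.Icc (L⁻¹ * T) (L * T) := ⟨by nlinarith, by nlinarith⟩
  obtain ⟨S, hSmem, hSmin⟩ := LowerSemicontinuousOn.exists_isMinOn ⟨T, hTmem⟩ isCompact_Icc
    ((lowerSemicontinuous_calJ hk hlam hX hY).lowerSemicontinuousOn _)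
  have hST : calJ P k lam X Y S ≤ calJ P k lam X Y T := hSmin hTmem
  have hl : L⁻¹ * T < S := by
    refine lt_of_le_of_ne hSmem.1 fun heq => ?_
    have := hout S (by rw [← heq]; gcongr) (hSmem.2.trans (by gcongr)) (Or.inl heq.ge)
    linarith
  have hr : S < L * T := by
    refine lt_of_le_of_ne hSmem.2 fun heq => ?_
    have := hout S (le_trans (by gcongr) hSmem.1) (by rw [heq]; gcongr) (Or.inr heq.ge)
    linarith
  have hS0 : 0 < S := lt_trans (by positivity) hl
  have hlow : ∀ S', L⁻¹ ^ 2 * S ≤ S' → L⁻¹ ^ 3 * T ≤ S' := fun S' h => by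
    refine le_trans ?_ h
    calc L⁻¹ ^ 3 * T = L⁻¹ ^ 2 * (L⁻¹ * T) := by ring
      _ ≤ L⁻¹ ^ 2 * S := by gcongr
  have hup : ∀ S', S' ≤ L ^ 2 * S → S' ≤ L ^ 3 * T := fun S' h => by
    refine le_trans h ?_
    calc L ^ 2 * S ≤ L ^ 2 * (L * T) := by gcongr
      _ = L ^ 3 * T := by ring
  have hmin : ∀ S', L⁻¹ ^ 2 * S ≤ S' → S' ≤ L ^ 2 * S →
      calJ P k lam X Y S ≤ calJ P k lam X Y S' := fun S' h1 h2 => by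
    by_cases hin : L⁻¹ * T < S' ∧ S' < L * T
    · exact hSmin ⟨hin.1.le, hin.2.le⟩
    · have hor : S' ≤ L⁻¹ * T ∨ L * T ≤ S' := by
        by_contra! hno
        exact hin hno
      have := hout S' (hlow S' h1) (hup S' h2) hor
      linarith
  have hL2 : 1 < L ^ 2 := one_lt_pow₀ hL (by norm_num)
  have hle : L⁻¹ ^ 2 * S ≤ L ^ 2 * S := by
    rw [inv_pow]
    exact (inv_mul_lt_mul hS0 hL2).le
  refine ⟨S, ⟨hS0, ⟨hS0.le, ?_⟩, ?_, ?_⟩, hl, hr⟩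
  · refine Filter.Eventually.filter_mono nhdsWithin_le_nhds ?_
    filter_upwards [Ioo_mem_nhds hl hr] with S' hS'
    exact hSmin ⟨hS'.1.le, hS'.2.le⟩
  · intro S' hS'
    rw [scaleNhd_eq_Icc hS0 hL2, ← inv_pow] at hS'
    exact hmin S' hS'.1 hS'.2
  · intro S' hS'
    rw [frontier_scaleNhd hS0 hL2, ← inv_pow] at hS'
    have hb : b ≤ calJ P k lam X Y S' := by
      rcases hS' with rfl | rfl
      · refine hout _ (hlow _ le_rfl) (hup _ hle) (Or.inl ?_)
        calc L⁻¹ ^ 2 * S ≤ L⁻¹ ^ 2 * (L * T) := by gcongr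
          _ = (L * L⁻¹) * (L⁻¹ * T) := by ring
          _ = L⁻¹ * T := by rw [hLi, one_mul]
      · refine hout _ (hlow _ hle) (hup _ le_rfl) (Or.inr ?_)
        calc L * T = (L * L⁻¹) * (L * T) := by rw [hLi, one_mul]
          _ = L ^ 2 * (L⁻¹ * T) := by ring
          _ ≤ L ^ 2 * S := by gcongr
    linarith

end Detectors

/-! ### Energies of sums and of clusters -/

section Sums

variable {Ω : Type*} [MeasurableSpace Ω] {P : Measure Ω} {X : Ω → ℝ} {k : ℝ → ℝ}

/-- The quadratic form of the triangle inequality in `L²(k)`. -/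
theorem kernelEnergy_sum_le {ι : Type*} [Fintype ι] (hk : IsFourierWeight k) (hX : Measurable X)
    {G : ι → Ω → ℂ} (hG : ∀ i, Integrable (G i) P) (s : ℝ) :
    kernelEnergy P k X (fun ω => ∑ i, G i ω) s
      ≤ Fintype.card ι * ∑ i, kernelEnergy P k X (G i) s := by
  have hi := fun i => integrable_kernelEnergy hk hX (hG i) s
  unfold kernelEnergy
  rw [← integral_finsetSum _ fun i _ => hi i, ← integral_const_mul]
  refine integral_mono (integrable_kernelEnergy hk hX (integrable_finsetSum _ fun i _ => hG i) s)
    ((integrable_finsetSum _ fun i _ => hi i).const_mul _) fun w => ?_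
  simp only
  rw [twistedMean_sum hX hG, ← Finset.mul_sum, mul_left_comm]
  refine mul_le_mul_of_nonneg_left ?_ (hk.pos w).le
  refine (pow_le_pow_left₀ (norm_nonneg _) (norm_sum_le _ _) 2).trans ?_
  have := sq_sum_le_card_mul_sum_sq (s := Finset.univ)
    (f := fun i => ‖twistedMean P X (G i) (s * w)‖)
  simpa using this

theorem kernelEnergy_neg (Y : Ω → ℂ) (s : ℝ) :
    kernelEnergy P k X (fun ω => -Y ω) s = kernelEnergy P k X Y s := by
  simp only [kernelEnergy, twistedMean, neg_mul, integral_neg, norm_neg]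

/-- The energy is dominated by the second moment of the target. -/
theorem kernelEnergy_le_integral_sq [IsProbabilityMeasure P] (hk : IsFourierWeight k)
    (hX : Measurable X) {Y : Ω → ℂ} (hY : MemLp Y 2 P) (s : ℝ) :
    kernelEnergy P k X Y s ≤ ∫ ω, ‖Y ω‖ ^ 2 ∂P := by
  have hYi := hY.integrable (μ := P) (by norm_num)
  have hsq : Integrable (fun ω => ‖Y ω‖ ^ 2) P := hY.integrable_norm_pow (by norm_num)
  refine (kernelEnergy_le hk hX hYi s).trans ?_
  set c := ∫ ω, ‖Y ω‖ ∂P with hc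
  have h1 : ∀ ω, 0 ≤ ‖Y ω‖ ^ 2 - (2 * c) * ‖Y ω‖ + c ^ 2 := fun ω => by
    have := sq_nonneg (‖Y ω‖ - c)
    linarith [sub_sq ‖Y ω‖ c]
  have h2 : 0 ≤ ∫ ω, (‖Y ω‖ ^ 2 - (2 * c) * ‖Y ω‖ + c ^ 2) ∂P := integral_nonneg h1
  have h3 : Integrable (fun ω => ‖Y ω‖ ^ 2 - (2 * c) * ‖Y ω‖) P := hsq.sub (hYi.norm.const_mul _)
  rw [integral_add h3 (integrable_const _), integral_sub hsq (hYi.norm.const_mul _),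
    integral_const_mul, ← hc] at h2
  simp only [integral_const, probReal_univ, one_smul] at h2
  linarith

end Sums

section ClusterTargets

variable {Ω : Type*} {m : ℕ} {X₀ : Ω → Fin m} {Z : Fin m → Ω → ℝ} {g : Fin m → ℝ → ℂ}
  {a σ : Fin m → ℝ}

theorem clusterX_of_eq {ω : Ω} {i : Fin m} (h : X₀ ω = i) :
    clusterX X₀ Z a σ ω = a i + σ i * Z i ω := by
  unfold clusterX
  rw [Finset.sum_eq_single i]
  · simp [h]
  · intro j _ hj
    simp [h, hj.symm]
  · simp

/-- The target `χ_i g_i(Z_i)` on the `i`-th cluster. -/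
noncomputable def clusterTarget (X₀ : Ω → Fin m) (Z : Fin m → Ω → ℝ) (g : Fin m → ℝ → ℂ)
    (i : Fin m) : Ω → ℂ :=
  (X₀ ⁻¹' {i}).indicator fun ω => g i (Z i ω)

theorem sum_clusterTarget_of_eq {ω : Ω} {i : Fin m} (h : X₀ ω = i) :
    ∑ j, clusterTarget X₀ Z g j ω = g i (Z i ω) := by
  unfold clusterTarget
  rw [Finset.sum_eq_single i]
  · simp [h]
  · intro j _ hj
    simp [h, hj.symm]
  · simp

/-- The part of `Y` that is not explained by the targets on the clusters. -/
noncomputable def targetError (X₀ : Ω → Fin m) (Z : Fin m → Ω → ℝ) (g : Fin m → ℝ → ℂ)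
    (Y : Ω → ℂ) (ω : Ω) : ℂ :=
  Y ω - ∑ i, clusterTarget X₀ Z g i ω

end ClusterTargets

section Clusters

variable {Ω : Type*} [MeasurableSpace Ω] {P : Measure Ω} {m : ℕ} {X₀ : Ω → Fin m}
  {Z : Fin m → Ω → ℝ} {g : Fin m → ℝ → ℂ} {a σ : Fin m → ℝ} {k : ℝ → ℝ}

theorem measurable_clusterX (hX₀ : Measurable X₀) (hZ : ∀ i, Measurable (Z i)) :
    Measurable (clusterX X₀ Z a σ) := by
  unfold clusterX
  refine Finset.measurable_sum _ fun i _ => Measurable.indicator ?_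
    (hX₀ (MeasurableSet.singleton i))
  exact ((hZ i).const_mul _).const_add _

theorem memLp_clusterTarget (hX₀ : Measurable X₀)
    (hg2 : ∀ i, MemLp (fun ω => g i (Z i ω)) 2 P) (i : Fin m) :
    MemLp (clusterTarget X₀ Z g i) 2 P :=
  (hg2 i).indicator (hX₀ (MeasurableSet.singleton i))

/-- The label is independent of the variables in the clusters. -/
theorem integral_indicator_of_indepFun [IsProbabilityMeasure P] {𝕜 : Type*} [RCLike 𝕜]
    (hX₀ : Measurable X₀) (hZ : ∀ i, Measurable (Z i))
    (hX₀ind : IndepFun X₀ (fun ω i => Z i ω) P) (i : Fin m) {F : ℝ → 𝕜} (hF : Measurable F) :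
    ∫ ω, (X₀ ⁻¹' {i}).indicator (fun ω => F (Z i ω)) ω ∂P
      = (P.real (X₀ ⁻¹' {i}) : 𝕜) * ∫ ω, F (Z i ω) ∂P := by
  have hm : MeasurableSet (X₀ ⁻¹' {i}) := hX₀ (MeasurableSet.singleton i)
  have hφ : Measurable (fun j : Fin m => if j = i then (1 : 𝕜) else 0) := measurable_of_finite _
  have hψ : Measurable (fun z : Fin m → ℝ => F (z i)) := hF.comp (measurable_pi_apply i)
  have hind := hX₀ind.comp hφ hψ
  have h1 := hind.integral_mul_eq_mul_integral (hφ.comp hX₀).aestronglyMeasurable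
    ((hF.comp (hZ i)).aestronglyMeasurable)
  have h2 : ∀ ω, (X₀ ⁻¹' {i}).indicator (fun ω => F (Z i ω)) ω
      = (((fun j : Fin m => if j = i then (1 : 𝕜) else 0) ∘ X₀) *
        ((fun z : Fin m → ℝ => F (z i)) ∘ fun ω i => Z i ω)) ω := by
    intro ω
    by_cases h : X₀ ω = i <;> simp [h]
  have h3 : ∫ ω, ((fun j : Fin m => if j = i then (1 : 𝕜) else 0) ∘ X₀) ω ∂P
      = (P.real (X₀ ⁻¹' {i}) : 𝕜) := by
    have : ((fun j : Fin m => if j = i then (1 : 𝕜) else 0) ∘ X₀)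
        = (X₀ ⁻¹' {i}).indicator fun _ => (1 : 𝕜) := by
      ext ω
      by_cases h : X₀ ω = i <;> simp [h]
    rw [this, integral_indicator_const _ hm]
    simp [RCLike.real_smul_eq_coe_mul]
  simp only [h2]
  rw [h1, h3]
  rfl

/-- Up to the phase of its center, the transform of the `i`-th cluster is a rescaled copy of the
transform of `g_i(Z_i)` over `Z_i`. -/
theorem twistedMean_clusterTarget [IsProbabilityMeasure P]
    (hX₀ : Measurable X₀) (hZ : ∀ i, Measurable (Z i))
    (hX₀ind : IndepFun X₀ (fun ω i => Z i ω) P) (hg : ∀ i, Measurable (g i)) (i : Fin m)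
    (t : ℝ) :
    twistedMean P (clusterX X₀ Z a σ) (clusterTarget X₀ Z g i) t
      = (Real.fourierChar (-(t * a i)) : ℂ) * ((P.real (X₀ ⁻¹' {i}) : ℂ) *
        twistedMean P (Z i) (fun ω => g i (Z i ω)) (t * σ i)) := by
  have hF : Measurable fun z : ℝ => g i z * (Real.fourierChar (-(t * σ i * z)) : ℂ) :=
    (hg i).mul (continuous_coe_fourierChar.measurable.comp (by fun_prop))
  have h := integral_indicator_of_indepFun hX₀ hZ hX₀ind i hF
  unfold twistedMean
  have hc : ((P.real (X₀ ⁻¹' {i}) : ℝ) : ℂ) = RCLike.ofReal (P.real (X₀ ⁻¹' {i})) := rfl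
  rw [hc, ← h, ← integral_const_mul]
  refine integral_congr_ae (Eventually.of_forall fun ω => ?_)
  by_cases hω : X₀ ω = i
  · have hmem : ω ∈ X₀ ⁻¹' {i} := hω
    simp only [clusterTarget, Set.indicator_of_mem hmem, clusterX_of_eq hω]
    have : -(t * (a i + σ i * Z i ω)) = -(t * a i) + -(t * σ i * Z i ω) := by ring
    rw [this, fourierChar_add]
    ring
  · have hmem : ω ∉ X₀ ⁻¹' {i} := hω
    simp only [clusterTarget, Set.indicator_of_notMem hmem, zero_mul, mul_zero]

/-- The energy `s ↦ P(X₀ = i)² ‖E[g_i(Z_i) K(·, sZ_i)]‖²` of a single normalized cluster. -/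
noncomputable def clusterEnergy (P : Measure Ω) (k : ℝ → ℝ) (X₀ : Ω → Fin m)
    (Z : Fin m → Ω → ℝ) (g : Fin m → ℝ → ℂ) (i : Fin m) (s : ℝ) : ℝ :=
  P.real (X₀ ⁻¹' {i}) ^ 2 * kernelEnergy P k (Z i) (fun ω => g i (Z i ω)) s

theorem kernelEnergy_clusterTarget [IsProbabilityMeasure P]
    (hX₀ : Measurable X₀) (hZ : ∀ i, Measurable (Z i))
    (hX₀ind : IndepFun X₀ (fun ω i => Z i ω) P) (hg : ∀ i, Measurable (g i)) (i : Fin m)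
    (U : ℝ) :
    kernelEnergy P k (clusterX X₀ Z a σ) (clusterTarget X₀ Z g i) U
      = clusterEnergy P k X₀ Z g i (U * σ i) := by
  unfold clusterEnergy kernelEnergy
  rw [← integral_const_mul]
  congr 1
  ext w
  rw [twistedMean_clusterTarget hX₀ hZ hX₀ind hg, norm_mul, Circle.norm_coe, one_mul, norm_mul,
    Complex.norm_real, Real.norm_of_nonneg measureReal_nonneg, mul_right_comm U w]
  ring

theorem memLp_targetError (hX₀ : Measurable X₀) (hg2 : ∀ i, MemLp (fun ω => g i (Z i ω)) 2 P)
    {Y : Ω → ℂ} (hY : MemLp Y 2 P) : MemLp (targetError X₀ Z g Y) 2 P :=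
  hY.sub (memLp_finsetSum _ fun i _ => memLp_clusterTarget hX₀ hg2 i)

theorem integral_eq_sum_setIntegral (hX₀ : Measurable X₀) {F : Ω → ℝ} (hF : Integrable F P) :
    ∫ ω, F ω ∂P = ∑ i, ∫ ω in X₀ ⁻¹' {i}, F ω ∂P := by
  have h1 : ∀ ω, F ω = ∑ i, (X₀ ⁻¹' {i}).indicator F ω := by
    intro ω
    rw [Finset.sum_eq_single (X₀ ω)]
    · simp
    · intro j _ hj
      simp [hj.symm]
    · simp
  have hm : ∀ i, MeasurableSet (X₀ ⁻¹' {i}) := fun i => hX₀ (MeasurableSet.singleton i)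
  calc ∫ ω, F ω ∂P = ∫ ω, ∑ i, (X₀ ⁻¹' {i}).indicator F ω ∂P := by simp only [← h1]
    _ = ∑ i, ∫ ω, (X₀ ⁻¹' {i}).indicator F ω ∂P :=
        integral_finsetSum _ fun i _ => hF.indicator (hm i)
    _ = ∑ i, ∫ ω in X₀ ⁻¹' {i}, F ω ∂P := by simp only [integral_indicator (hm _)]

theorem integral_targetError_sq_le (hX₀ : Measurable X₀)
    (hg2 : ∀ i, MemLp (fun ω => g i (Z i ω)) 2 P) (hσ : ∀ i, 0 < σ i) {Y : Ω → ℂ}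
    (hY : MemLp Y 2 P) {δ : ℝ}
    (hδ : ∀ i, ∫ ω in X₀ ⁻¹' {i}, ‖Y ω - g i ((clusterX X₀ Z a σ ω - a i) / σ i)‖ ^ 2 ∂P ≤ δ) :
    ∫ ω, ‖targetError X₀ Z g Y ω‖ ^ 2 ∂P ≤ m * δ := by
  have hint : Integrable (fun ω => ‖targetError X₀ Z g Y ω‖ ^ 2) P :=
    (memLp_targetError hX₀ hg2 hY).integrable_norm_pow (by norm_num)
  rw [integral_eq_sum_setIntegral hX₀ hint]
  calc ∑ i, ∫ ω in X₀ ⁻¹' {i}, ‖targetError X₀ Z g Y ω‖ ^ 2 ∂P ≤ ∑ _i : Fin m, δ := by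
        refine Finset.sum_le_sum fun i _ => ?_
        refine le_trans (le_of_eq ?_) (hδ i)
        refine setIntegral_congr_fun (hX₀ (MeasurableSet.singleton i)) fun ω hω => ?_
        have hω' : X₀ ω = i := hω
        simp only [targetError]
        rw [sum_clusterTarget_of_eq hω', clusterX_of_eq hω', add_sub_cancel_left,
          mul_div_cancel_left₀ _ (hσ i).ne']
    _ = m * δ := by simp

/-- The total energy is, up to a constant, at most the sum of the energies of the clusters. -/
theorem kernelEnergy_le_sum_clusterEnergy [IsProbabilityMeasure P] (hk : IsFourierWeight k)
    (hX₀ : Measurable X₀) (hZ : ∀ i, Measurable (Z i))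
    (hX₀ind : IndepFun X₀ (fun ω i => Z i ω) P) (hg : ∀ i, Measurable (g i))
    (hg2 : ∀ i, MemLp (fun ω => g i (Z i ω)) 2 P) {Y : Ω → ℂ} (hY : MemLp Y 2 P) (U : ℝ) :
    kernelEnergy P k (clusterX X₀ Z a σ) Y U
      ≤ (m + 1) * (∫ ω, ‖targetError X₀ Z g Y ω‖ ^ 2 ∂P
        + ∑ j, clusterEnergy P k X₀ Z g j (U * σ j)) := by
  have hX := measurable_clusterX (a := a) (σ := σ) hX₀ hZ
  have hR := memLp_targetError (g := g) hX₀ hg2 hY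
  set H : Option (Fin m) → Ω → ℂ :=
    fun o => o.elim (targetError X₀ Z g Y) fun j => clusterTarget X₀ Z g j with hH
  have hHi : ∀ o, Integrable (H o) P := by
    rintro (_ | j)
    · exact hR.integrable (by norm_num)
    · exact (memLp_clusterTarget hX₀ hg2 j).integrable (by norm_num)
  have hsum : Y = fun ω => ∑ o, H o ω := by
    ext ω
    simp [hH, Fintype.sum_option, targetError]
  have h := kernelEnergy_sum_le hk hX hHi U
  rw [← hsum, Fintype.sum_option] at h
  simp only [hH, Option.elim, kernelEnergy_clusterTarget hX₀ hZ hX₀ind hg, Fintype.card_option,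
    Fintype.card_fin, Nat.cast_add, Nat.cast_one] at h
  refine h.trans ?_
  gcongr
  exact kernelEnergy_le_integral_sq hk hX hR U

/-- The energy of one cluster is, up to a constant, at most the total energy and the energies of
the other clusters. -/
theorem clusterEnergy_le [IsProbabilityMeasure P] (hk : IsFourierWeight k)
    (hX₀ : Measurable X₀) (hZ : ∀ i, Measurable (Z i))
    (hX₀ind : IndepFun X₀ (fun ω i => Z i ω) P) (hg : ∀ i, Measurable (g i))
    (hg2 : ∀ i, MemLp (fun ω => g i (Z i ω)) 2 P) {Y : Ω → ℂ} (hY : MemLp Y 2 P) (U : ℝ)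
    (i : Fin m) :
    clusterEnergy P k X₀ Z g i (U * σ i)
      ≤ (m + 1) * (∫ ω, ‖targetError X₀ Z g Y ω‖ ^ 2 ∂P
        + (kernelEnergy P k (clusterX X₀ Z a σ) Y U
          + ∑ j ∈ Finset.univ.erase i, clusterEnergy P k X₀ Z g j (U * σ j))) := by
  have hX := measurable_clusterX (a := a) (σ := σ) hX₀ hZ
  have hR := memLp_targetError (g := g) hX₀ hg2 hY
  -- `χ_i g_i(Z_i)` is `Y` minus the error and minus the other cluster targets.
  set H : Option (Fin m) → Ω → ℂ := fun o => o.elim (fun ω => -targetError X₀ Z g Y ω)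
    fun j => if j = i then Y else fun ω => -clusterTarget X₀ Z g j ω with hH
  have hHi : ∀ o, Integrable (H o) P := by
    rintro (_ | j)
    · exact (hR.integrable (by norm_num)).neg
    · by_cases hj : j = i
      · simpa [hH, hj] using hY.integrable (by norm_num)
      · simpa [hH, hj] using (memLp_clusterTarget hX₀ hg2 j).integrable (by norm_num)
  have hsum : clusterTarget X₀ Z g i = fun ω => ∑ o, H o ω := by
    ext ω
    have h1 := Finset.add_sum_erase Finset.univ (fun j => clusterTarget X₀ Z g j ω)
      (Finset.mem_univ i)
    have h2 := Finset.add_sum_erase Finset.univ (fun j => H (some j) ω) (Finset.mem_univ i)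
    have h3 : ∑ j ∈ Finset.univ.erase i, H (some j) ω
        = -∑ j ∈ Finset.univ.erase i, clusterTarget X₀ Z g j ω := by
      rw [← Finset.sum_neg_distrib]
      refine Finset.sum_congr rfl fun j hj => ?_
      simp [hH, Finset.ne_of_mem_erase hj]
    rw [Fintype.sum_option, ← h2, h3]
    simp only [hH, Option.elim, if_true, targetError]
    rw [← h1]
    ring
  have h := kernelEnergy_sum_le hk hX hHi U
  rw [← hsum, Fintype.sum_option,
    ← Finset.add_sum_erase Finset.univ (fun j => kernelEnergy P k _ (H (some j)) U)
      (Finset.mem_univ i)] at h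
  have h3 : ∑ j ∈ Finset.univ.erase i, kernelEnergy P k (clusterX X₀ Z a σ) (H (some j)) U
      = ∑ j ∈ Finset.univ.erase i, clusterEnergy P k X₀ Z g j (U * σ j) := by
    refine Finset.sum_congr rfl fun j hj => ?_
    simp only [hH, Option.elim, Finset.ne_of_mem_erase hj, if_false]
    rw [kernelEnergy_neg, kernelEnergy_clusterTarget hX₀ hZ hX₀ind hg]
  rw [h3, kernelEnergy_clusterTarget hX₀ hZ hX₀ind hg] at h
  simp only [hH, Option.elim, if_true, kernelEnergy_neg, Fintype.card_option,
    Fintype.card_fin, Nat.cast_add, Nat.cast_one] at h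
  refine h.trans ?_
  gcongr
  exact kernelEnergy_le_integral_sq hk hX hR U

end Clusters

/-! ### Scale separation -/

theorem le_mul_of_consecutive_le {m : ℕ} {σ : Fin m → ℝ} (hσ : ∀ i, 0 < σ i) {δ : ℝ}
    (hδ0 : 0 < δ) (hδ1 : δ ≤ 1) (h : ∀ i j : Fin m, (i : ℕ) + 1 = j → σ i / σ j ≤ δ)
    {i j : Fin m} (hij : i < j) : σ i ≤ δ * σ j := by
  have key : ∀ d : ℕ, ∀ i j : Fin m, (i : ℕ) + d + 1 = j → σ i ≤ δ * σ j := by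
    intro d
    induction d with
    | zero => exact fun i j hd => (div_le_iff₀ (hσ j)).1 (h i j (by simpa using hd))
    | succ d ih =>
      intro i j hd
      have h1 := ih i ⟨i + d + 1, by omega⟩ rfl
      have h2 := (div_le_iff₀ (hσ j)).1 (h ⟨i + d + 1, by omega⟩ j (by simp only; omega))
      have h3 : δ * σ j ≤ σ j := mul_le_of_le_one_left (hσ j).le hδ1
      exact h1.trans (mul_le_mul_of_nonneg_left (h2.trans h3) hδ0.le)
  have hij' : (i : ℕ) < j := hij
  exact key (j - i - 1) i j (by omega)

/-- A scale comparable with `σ_i` is far from `σ_j`. -/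
theorem mul_sq_le_or_le_of_ne {m : ℕ} {σ : Fin m → ℝ} (hσ : ∀ i, 0 < σ i) {L δ : ℝ} (hL : 1 < L)
    (hδ0 : 0 < δ) (hδL : δ ≤ L⁻¹ ^ 2)
    (h : ∀ i j : Fin m, (i : ℕ) + 1 = j → σ i / σ j ≤ δ) {i j : Fin m} (hij : j ≠ i) {S : ℝ}
    (h1 : L⁻¹ ^ 3 * (σ i ^ 2)⁻¹ ≤ S) (h2 : S ≤ L ^ 3 * (σ i ^ 2)⁻¹) :
    S * σ j ^ 2 ≤ L⁻¹ ∨ L ≤ S * σ j ^ 2 := by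
  have hL0 : 0 < L := by linarith
  have hi0 : 0 < L⁻¹ := inv_pos.2 hL0
  have hLi : L * L⁻¹ = 1 := mul_inv_cancel₀ hL0.ne'
  have hi1 : L⁻¹ < 1 := inv_lt_one_of_one_lt₀ hL
  have hδ1 : δ ≤ 1 := hδL.trans (pow_le_one₀ hi0.le hi1.le)
  have hi := hσ i
  have hj := hσ j
  rcases lt_or_gt_of_ne hij with hlt | hgt
  · left
    have h3 : σ j ≤ L⁻¹ ^ 2 * σ i := (le_mul_of_consecutive_le hσ hδ0 hδ1 h hlt).trans
      (mul_le_mul_of_nonneg_right hδL hi.le)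
    calc S * σ j ^ 2 ≤ L ^ 3 * (σ i ^ 2)⁻¹ * (L⁻¹ ^ 2 * σ i) ^ 2 := by gcongr
      _ = (L * L⁻¹) ^ 3 * L⁻¹ * ((σ i ^ 2)⁻¹ * σ i ^ 2) := by ring
      _ = L⁻¹ := by rw [hLi, inv_mul_cancel₀ (by positivity)]; ring
  · right
    have h3 : σ i ≤ L⁻¹ ^ 2 * σ j := (le_mul_of_consecutive_le hσ hδ0 hδ1 h hgt).trans
      (mul_le_mul_of_nonneg_right hδL hj.le)
    have h4 : L ^ 2 * σ i ≤ σ j := by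
      calc L ^ 2 * σ i ≤ L ^ 2 * (L⁻¹ ^ 2 * σ j) := by gcongr
        _ = (L * L⁻¹) ^ 2 * σ j := by ring
        _ = σ j := by rw [hLi]; ring
    calc L = (L * L⁻¹) ^ 3 * L * ((σ i ^ 2)⁻¹ * σ i ^ 2) := by
          rw [hLi, inv_mul_cancel₀ (by positivity)]; ring
      _ = L⁻¹ ^ 3 * (σ i ^ 2)⁻¹ * (L ^ 2 * σ i) ^ 2 := by ring
      _ ≤ S * σ j ^ 2 := by gcongr; exact le_trans (by positivity) h1

/-- Away from the unit scale, by a factor that only depends on the functions, finitely many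
functions that vanish at `0` and at infinity are uniformly small. -/
theorem exists_window {ι : Type*} [Finite ι] {q : ι → ℝ → ℝ}
    (h0 : ∀ i, Tendsto (q i) (𝓝 0) (𝓝 0)) (h1 : ∀ i, Tendsto (q i) atTop (𝓝 0)) {γ : ℝ}
    (hγ : 0 < γ) :
    ∃ L : ℝ, 1 < L ∧ ∀ i s, 0 < s → (s ^ 2 ≤ L⁻¹ ∨ L ≤ s ^ 2) → q i s ≤ γ := by
  have e0 : ∀ᶠ s in 𝓝 (0 : ℝ), ∀ i, q i s < γ :=
    eventually_all.2 fun i => (h0 i).eventually (gt_mem_nhds hγ)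
  have e1 : ∀ᶠ s in atTop, ∀ i, q i s < γ :=
    eventually_all.2 fun i => (h1 i).eventually (gt_mem_nhds hγ)
  obtain ⟨r, hr, hr'⟩ := Metric.eventually_nhds_iff.1 e0
  obtain ⟨R, hR⟩ := eventually_atTop.1 e1
  have hr2 : 0 < 1 / r ^ 2 := by positivity
  have hL0 : 0 < 2 + 1 / r ^ 2 + R ^ 2 := by positivity
  refine ⟨2 + 1 / r ^ 2 + R ^ 2, by nlinarith [sq_nonneg R], fun i s hs h => ?_⟩
  rcases h with h | h
  · refine (hr' ?_ i).le
    rw [Real.dist_eq, sub_zero, abs_of_pos hs]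
    refine lt_of_pow_lt_pow_left₀ 2 hr.le (h.trans_lt ?_)
    rw [inv_lt_comm₀ hL0 (by positivity), ← one_div]
    nlinarith [sq_nonneg R]
  · refine (hR s ?_ i).le
    by_contra! hlt
    nlinarith

theorem integral_norm_add_sq_le {Ω : Type*} [MeasurableSpace Ω] {P : Measure Ω}
    {A B : Ω → ℂ} (hA : MemLp A 2 P) (hB : MemLp B 2 P) :
    ∫ ω, ‖A ω + B ω‖ ^ 2 ∂P ≤ 2 * (∫ ω, ‖A ω‖ ^ 2 ∂P) + 2 * ∫ ω, ‖B ω‖ ^ 2 ∂P := by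
  have hA' : Integrable (fun ω => ‖A ω‖ ^ 2) P := hA.integrable_norm_pow (by norm_num)
  have hB' : Integrable (fun ω => ‖B ω‖ ^ 2) P := hB.integrable_norm_pow (by norm_num)
  rw [← integral_const_mul, ← integral_const_mul,
    ← integral_add (hA'.const_mul 2) (hB'.const_mul 2)]
  refine integral_mono ((hA.add hB).integrable_norm_pow (by norm_num))
    ((hA'.const_mul 2).add (hB'.const_mul 2)) fun ω => ?_
  have h1 := pow_le_pow_left₀ (norm_nonneg _) (norm_add_le (A ω) (B ω)) 2
  have h2 := sq_nonneg (‖A ω‖ - ‖B ω‖)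
  simp only
  linarith [sub_sq ‖A ω‖ ‖B ω‖, add_sq ‖A ω‖ ‖B ω‖]

section Clusters

variable {Ω : Type*} [MeasurableSpace Ω] {P : Measure Ω} [IsProbabilityMeasure P] {m : ℕ}
  {X₀ : Ω → Fin m} {Z : Fin m → Ω → ℝ} {g : Fin m → ℝ → ℂ} {k : ℝ → ℝ}

theorem integral_sum_clusterTarget_sq_pos [NeZero m] (hX₀ : Measurable X₀)
    (hp : ∀ i, 0 < P (X₀ ⁻¹' {i})) (hZ : ∀ i, Measurable (Z i))
    (hX₀ind : IndepFun X₀ (fun ω i => Z i ω) P) (hg : ∀ i, Measurable (g i))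
    (hg2 : ∀ i, MemLp (fun ω => g i (Z i ω)) 2 P)
    (hgpos : ∀ i, 0 < ∫ ω, ‖g i (Z i ω)‖ ^ 2 ∂P) :
    0 < ∫ ω, ‖∑ i, clusterTarget X₀ Z g i ω‖ ^ 2 ∂P := by
  have hint : Integrable (fun ω => ‖∑ i, clusterTarget X₀ Z g i ω‖ ^ 2) P :=
    (memLp_finsetSum _ fun i _ => memLp_clusterTarget hX₀ hg2 i).integrable_norm_pow (by norm_num)
  rw [integral_eq_sum_setIntegral hX₀ hint]
  refine Finset.sum_pos (fun i _ => ?_) ⟨⊤, Finset.mem_univ _⟩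
  have hm : MeasurableSet (X₀ ⁻¹' {i}) := hX₀ (MeasurableSet.singleton i)
  have h1 : ∫ ω in X₀ ⁻¹' {i}, ‖∑ i, clusterTarget X₀ Z g i ω‖ ^ 2 ∂P
      = ∫ ω in X₀ ⁻¹' {i}, ‖g i (Z i ω)‖ ^ 2 ∂P :=
    setIntegral_congr_fun hm fun ω hω => by
      have hω' : X₀ ω = i := hω
      simp only [sum_clusterTarget_of_eq hω']
  have h2 := integral_indicator_of_indepFun (𝕜 := ℝ) hX₀ hZ hX₀ind i
    (F := fun z => ‖g i z‖ ^ 2) ((hg i).norm.pow_const 2)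
  rw [integral_indicator hm] at h2
  rw [h1, h2]
  exact mul_pos (ENNReal.toReal_pos (hp i).ne' (measure_ne_top _ _)) (hgpos i)

end Clusters

end KernelLearning

open KernelLearning in
theorem mainTheorem3
    {Ω : Type*} [MeasurableSpace Ω] (P : Measure Ω) [IsProbabilityMeasure P]
    (k : ℝ → ℝ) (hk : IsFourierWeight k) (lam : ℝ) (hlam : 0 < lam)
    (m : ℕ) [NeZero m]
    (X₀ : Ω → Fin m) (hX₀ : Measurable X₀) (hp : ∀ i, 0 < P (X₀ ⁻¹' {i}))
    (Z : Fin m → Ω → ℝ) (hZ : ∀ i, Measurable (Z i))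
    (hZcont : ∀ i x, P (Z i ⁻¹' {x}) = 0)
    (hZ2 : ∀ i, MemLp (Z i) 2 P) (hZ0 : ∀ i, ∫ ω, Z i ω ∂P = 0)
    (hZind : iIndepFun Z P) (hX₀ind : IndepFun X₀ (fun ω i => Z i ω) P)
    (g : Fin m → ℝ → ℂ) (hg : ∀ i, Measurable (g i))
    (hg2 : ∀ i, MemLp (fun ω => g i (Z i ω)) 2 P)
    (hgpos : ∀ i, 0 < ∫ ω, ‖g i (Z i ω)‖ ^ 2 ∂P)
    (hg0 : ∀ i, ∫ ω, g i (Z i ω) ∂P = 0) :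
    ∃ ε : ℝ, 0 < ε ∧ ∃ Λ : ℝ, 1 < Λ ∧ ∀ C : ℝ, 0 < C → ∃ δ : ℝ, 0 < δ ∧
      ∀ (σ a : Fin m → ℝ) (Y : Ω → ℂ),
        (∀ i, 0 < σ i) →
        (∀ i j : Fin m, (i : ℕ) + 1 = j → σ i / σ j ≤ δ) →
        (∀ i j : Fin m, i ≠ j → C⁻¹ * σ ⊤ ≤ |a i - a j|) →
        MemLp Y 2 P →
        (∀ i, ∫ ω in X₀ ⁻¹' {i},
          ‖Y ω - g i ((clusterX X₀ Z a σ ω - a i) / σ i)‖ ^ 2 ∂P ≤ δ) →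
        (∀ S : ℝ, IsScaleDetector P k lam (clusterX X₀ Z a σ) Y ε Λ S →
          ∃ i, Λ⁻¹ * (σ i ^ 2)⁻¹ < S ∧ S < Λ * (σ i ^ 2)⁻¹) ∧
        (∀ i, ∃ S : ℝ, IsScaleDetector P k lam (clusterX X₀ Z a σ) Y ε (Λ ^ 2) S ∧
          Λ⁻¹ * (σ i ^ 2)⁻¹ < S ∧ S < Λ * (σ i ^ 2)⁻¹) := by
  have hgi : ∀ i, Integrable (fun ω => g i (Z i ω)) P := fun i => (hg2 i).integrable (by norm_num)
  have hm0 : (0 : ℝ) < m := Nat.cast_pos.2 (NeZero.pos m)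
  set q := clusterEnergy P k X₀ Z g with hq
  have hq0 : ∀ i, Tendsto (q i) (𝓝 0) (𝓝 0) := fun i => by
    have h := (tendsto_kernelEnergy_zero hk (hZ i) (hgi i) (hg0 i)).const_mul
      (P.real (X₀ ⁻¹' {i}) ^ 2)
    rwa [mul_zero] at h
  have hq1 : ∀ i, Tendsto (q i) atTop (𝓝 0) := fun i => by
    have h := (tendsto_kernelEnergy_atTop hk (hZ i) (hZcont i) (hgi i)).const_mul
      (P.real (X₀ ⁻¹' {i}) ^ 2)
    rwa [mul_zero] at h
  have hqpos : ∀ i, 0 < q i 1 := fun i =>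
    mul_pos (pow_pos (ENNReal.toReal_pos (hp i).ne' (measure_ne_top _ _)) 2)
      (kernelEnergy_pos hk (hZ i) (hg i) (hgi i) (hgpos i) one_pos)
  obtain ⟨i₀, hi₀⟩ := Finite.exists_min fun i => q i 1
  set α := q i₀ 1 with hα
  have hα0 : 0 < α := hqpos i₀
  set V := ∫ ω, ‖∑ i, clusterTarget X₀ Z g i ω‖ ^ 2 ∂P with hV
  have hV0 : 0 < V := integral_sum_clusterTarget_sq_pos hX₀ hp hZ hX₀ind hg hg2 hgpos
  -- `β` is the guaranteed depth of the dips of `𝓙` below `½ E|Y|²`, and `β / 64` bounds the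
  -- distance to `½ E|Y|²` away from the scales of the clusters. As `V / 4 ≤ E|Y|² ≤ 4 V`, the
  -- gap `ε E|Y|²` with `ε = β / (8 V)` lies between `β / 32` and `β / 2`. The number `κ` bounds
  -- the total energy of the invisible clusters and of the error of the target.
  set n : ℝ := m + 1 with hn
  have hn0 : 0 < n := by positivity
  set β := α / (4 * n * (1 + lam)) with hβ
  have hβ0 : 0 < β := by positivity
  set κ := min (2 * lam * (β / 64) / n) (α / (2 * n)) with hκ
  have hκ0 : 0 < κ := by positivity
  set γ := κ / (2 * m) with hγ
  have hγ0 : 0 < γ := by positivity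
  obtain ⟨L, hL, hwin⟩ := exists_window hq0 hq1 hγ0
  have hL0 : 0 < L := by linarith
  refine ⟨β / (8 * V), by positivity, L, hL, fun C _ =>
    ⟨min (min γ (V / (4 * m))) (L⁻¹ ^ 2), by positivity, ?_⟩⟩
  set δ := min (min γ (V / (4 * m))) (L⁻¹ ^ 2) with hδ
  have hδ0 : 0 < δ := by positivity
  intro σ a Y hσ hratio _ hY herr
  have hX := measurable_clusterX (a := a) (σ := σ) hX₀ hZ
  have hR := memLp_targetError (g := g) hX₀ hg2 hY
  have hρ := integral_targetError_sq_le hX₀ hg2 hσ hY herr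
  set ρ := ∫ ω, ‖targetError X₀ Z g Y ω‖ ^ 2 ∂P with hρdef
  set E := ∫ ω, ‖Y ω‖ ^ 2 ∂P with hE
  have hmδγ : m * δ + m * γ ≤ κ := by
    have h1 : δ ≤ γ := (min_le_left _ _).trans (min_le_left _ _)
    have h2 : m * γ + m * γ = κ := by rw [hγ]; field_simp; ring
    nlinarith
  have hρV : ρ ≤ V / 4 := by
    have h1 : δ ≤ V / (4 * m) := (min_le_left _ _).trans (min_le_right _ _)
    calc ρ ≤ m * δ := hρ
      _ ≤ m * (V / (4 * m)) := by gcongr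
      _ = V / 4 := by field_simp
  have hsumLp : MemLp (fun ω => ∑ i, clusterTarget X₀ Z g i ω) 2 P :=
    memLp_finsetSum _ fun i _ => memLp_clusterTarget hX₀ hg2 i
  have hEup : E ≤ 4 * V := by
    have h := integral_norm_add_sq_le hsumLp hR
    have heq : ∀ ω, ∑ i, clusterTarget X₀ Z g i ω + targetError X₀ Z g Y ω = Y ω :=
      fun ω => add_sub_cancel _ _
    simp only [heq] at h
    linarith
  have hElow : V / 4 ≤ E := by
    have h := integral_norm_add_sq_le hY hR.neg
    have heq : ∀ ω, Y ω + -targetError X₀ Z g Y ω = ∑ i, clusterTarget X₀ Z g i ω := fun ω => by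
      rw [targetError, neg_sub, add_sub_cancel]
    simp only [Pi.neg_apply, norm_neg, heq] at h
    linarith
  have hεlow : β / 64 < β / (8 * V) * E := by
    calc β / 64 < β / (8 * V) * (V / 4) := by
          rw [show β / (8 * V) * (V / 4) = β / 32 by field_simp; ring]; linarith
      _ ≤ β / (8 * V) * E := by gcongr
  have hεup : β / (8 * V) * E ≤ β / 2 := by
    calc β / (8 * V) * E ≤ β / (8 * V) * (4 * V) := by gcongr
      _ = β / 2 := by field_simp; ring
  have hout : ∀ S, 0 < S → (∀ j, S * σ j ^ 2 ≤ L⁻¹ ∨ L ≤ S * σ j ^ 2) →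
      1 / 2 * E - β / 64 ≤ calJ P k lam (clusterX X₀ Z a σ) Y S := by
    intro S hS hsep
    refine le_trans ?_ (le_minLoss hk hlam hX hY (Real.sqrt S))
    have h1 := kernelEnergy_le_sum_clusterEnergy (a := a) (σ := σ) hk hX₀ hZ hX₀ind hg hg2 hY
      (Real.sqrt S)
    have h2 : ∑ j, q j (Real.sqrt S * σ j) ≤ m * γ := by
      calc ∑ j, q j (Real.sqrt S * σ j) ≤ ∑ _j : Fin m, γ := by
            refine Finset.sum_le_sum fun j _ => hwin j _ (mul_pos (Real.sqrt_pos.2 hS) (hσ j)) ?_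
            rw [mul_pow, Real.sq_sqrt hS.le]
            exact hsep j
        _ = m * γ := by simp
    have h3 : kernelEnergy P k (clusterX X₀ Z a σ) Y (Real.sqrt S) ≤ n * κ :=
      h1.trans (mul_le_mul_of_nonneg_left (by linarith) hn0.le)
    have h4 : n * κ ≤ 2 * lam * (β / 64) := by
      calc n * κ ≤ n * (2 * lam * (β / 64) / n) := by gcongr; exact min_le_left _ _
        _ = 2 * lam * (β / 64) := by field_simp
    have h5 : kernelEnergy P k (clusterX X₀ Z a σ) Y (Real.sqrt S) / (2 * lam) ≤ β / 64 := by
      rw [div_le_iff₀ (by positivity)]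
      linarith
    linarith
  refine ⟨fun S hS => ?_, fun i => ?_⟩
  · by_contra! hno
    refine not_isScaleDetector hk hlam hX hY hL ?_ hS
    have h := hout S hS.pos fun j => by
      have hσj : 0 < σ j ^ 2 := pow_pos (hσ j) 2
      rcases le_or_gt S (L⁻¹ * (σ j ^ 2)⁻¹) with hle | hgt
      · left
        rwa [← div_eq_mul_inv, le_div_iff₀ hσj] at hle
      · right
        have := hno j hgt
        rwa [← div_eq_mul_inv, div_le_iff₀ hσj] at this
    linarith
  · have hσi : 0 < σ i ^ 2 := pow_pos (hσ i) 2
    have hT : 0 < (σ i ^ 2)⁻¹ := inv_pos.2 hσi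
    have hδL : δ ≤ L⁻¹ ^ 2 := min_le_right _ _
    have hdip : calJ P k lam (clusterX X₀ Z a σ) Y (σ i ^ 2)⁻¹ ≤ 1 / 2 * E - β := by
      have hsqrt : Real.sqrt (σ i ^ 2)⁻¹ = (σ i)⁻¹ := by
        rw [Real.sqrt_inv, Real.sqrt_sq (hσ i).le]
      unfold calJ
      rw [hsqrt]
      refine (minLoss_le hk hlam hX hY _).trans ?_
      have h1 := clusterEnergy_le (a := a) (σ := σ) hk hX₀ hZ hX₀ind hg hg2 hY (σ i)⁻¹ i
      rw [inv_mul_cancel₀ (hσ i).ne'] at h1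
      have h2 : ∑ j ∈ Finset.univ.erase i, q j ((σ i)⁻¹ * σ j) ≤ m * γ := by
        calc ∑ j ∈ Finset.univ.erase i, q j ((σ i)⁻¹ * σ j)
            ≤ ∑ _j ∈ Finset.univ.erase i, γ := by
              refine Finset.sum_le_sum fun j hj =>
                hwin j _ (mul_pos (inv_pos.2 (hσ i)) (hσ j)) ?_
              rw [mul_pow, inv_pow]
              refine mul_sq_le_or_le_of_ne hσ hL hδ0 hδL hratio (Finset.ne_of_mem_erase hj) ?_ ?_
              · exact mul_le_of_le_one_left hT.le
                  (pow_le_one₀ (inv_pos.2 hL0).le (inv_lt_one_of_one_lt₀ hL).le)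
              · exact le_mul_of_one_le_left hT.le (one_le_pow₀ hL.le)
          _ ≤ ∑ _j : Fin m, γ :=
              Finset.sum_le_sum_of_subset_of_nonneg (Finset.erase_subset _ _)
                fun _ _ _ => hγ0.le
          _ = m * γ := by simp
      set Q := kernelEnergy P k (clusterX X₀ Z a σ) Y (σ i)⁻¹
      have h3 : α ≤ n * (κ + Q) := (hi₀ i).trans
        (h1.trans (mul_le_mul_of_nonneg_left (by linarith) hn0.le))
      have h4 : n * κ ≤ α / 2 := by
        calc n * κ ≤ n * (α / (2 * n)) := by gcongr; exact min_le_right _ _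
          _ = α / 2 := by field_simp
      have h5 : β ≤ Q / (2 * (1 + lam)) := by
        rw [hβ, div_le_div_iff₀ (by positivity) (by positivity)]
        have : α ≤ 2 * (n * Q) := by linarith
        nlinarith
      linarith
    refine exists_isScaleDetector (b := 1 / 2 * E - β / 64) hk hlam hX hY hL hT (by linarith)
      (by linarith) fun S h1 h2 hor => ?_
    have hS : 0 < S := lt_of_lt_of_le (by positivity) h1
    refine hout S hS fun j => ?_
    by_cases hji : j = i
    · subst hji
      refine hor.imp (fun h => ?_) fun h => ?_
      · rwa [← div_eq_mul_inv, le_div_iff₀ hσi] at h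
      · rwa [← div_eq_mul_inv, div_le_iff₀ hσi] at h
    · exact mul_sq_le_or_le_of_ne hσ hL hδ0 hδL hratio hji h1 h2
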